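/- **Setting.** Fix $d\ge 2$ and constants $C_x,M,C,r>0$, $s\in[0,1]$, $C_0\ge 1$, $b_0,\gamma_0>0$, $c_0\ge0$, $\tilde c\in(0,1/2)$, $q\in(0,1)$ and $q_0>0$ with $q_0q\le C_x^2$. Let $z_i=(x_i,y_i)$, $i\ge1$, be identically distributed random elements of $\mathbb R^d\times\mathbb R$ with common law $P$ (the law of $(X,Y)$), and let $\theta^*\in\mathbb R^d$. Put $\Sigma=E[XX^\top]$. Assume: - $E[Y\mid X]=X^\top\theta^*$, and $\|X\|_2\le C_x$, $|Y|\le M$ almost surely; - geometric $\tau$-mixing: for all $j\ge1$, $\tau_j\le c_0\exp(-(b_0j)^{\gamma_0})$, where $\tau_j=\sup_{i,f}\|E(f(z_{i+j})\mid z_1,\dots,z_i)-Ef(z_{i+j})\|_\infty$, the supremum being over $i\ge 1$ and over bounded functions $f$ on $\mathbb R^d\times\mathbb R$ that are $1$-Lipschitz for the Euclidean norm; - source condition: $\|\Sigma^{-r}\theta^*\|_2\le C$, that is, $\theta^*=\Sigma^rh$ with $\|h\|_2\le C$; - effective dimension: $\operatorname{Tr}(\Sigma(\Sigma+\lambda I)^{-1})\le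 C_0\lambda^{-s}$ for all $\lambda>0$. Let $(g_\lambda)_{0<\lambda\le C_x^2}$ be a filter with bound $b>0$, qualification $\nu_g\in[1/2,\infty]$ and constants $\gamma_\nu>0$: for all $0<\sigma\le C_x^2$, $|g_\lambda(\sigma)|\le b/\lambda$, $|g_\lambda(\sigma)\sigma|\le b$, and $|1-g_\lambda(\sigma)\sigma|\sigma^\nu\le\gamma_\nu\lambda^\nu$ for all $0<\nu\le\nu_g$. Assume $\nu_g\ge\frac{2r+1}{2r+s+1}$ (this is automatic when $\nu_g\ge1$). For the sample $D=\{(x_i,y_i)\}_{i\le|D|}$ put $\widehat\Sigma_D=\frac1{|D|}\sum_i x_ix_i^\top$, $\widehat E_D[XY]=\frac1{|D|}\sum_i y_ix_i$, $\theta_{D,\lambda}=g_\lambda(\widehat\Sigma_D)\widehat E_D[XY]$, and $$|D|_\gamma=\frac{|D|b_0}{2\max\{1,\log(c_1^*|D|)\}^{1/\gamma_0}},\qquad c_1^*=c_0b_0\max\Big\{\tfrac{\sqrt2\max\{M+2C_x\|\theta^*\|_2,\,C_x\}}{2C_xM},\tfrac1{C_x}\Big\},\qquad \ell_3=\frac{|D|b_0}{2\max\{1,\log(b_0c_0|D|\tfrac{2\sqrt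 d}{C_x})\}^{1/\gamma_0}},$$ $$\mathcal W_{D,\lambda}=\frac{\Big(1+4\big(\tfrac{13C_x}{\sqrt{\lambda\ell_3}}+\tfrac{21C_x^2}{\lambda\ell_3}\big)\Big)\max\Big\{\sqrt{\operatorname{Tr}(\widehat\Sigma_D(\widehat\Sigma_D+\lambda I)^{-1})},1\Big\}}{\sqrt{|D|_\gamma}}+\frac1{|D|_\gamma\sqrt\lambda}.$$ **Selection rule.** For $\delta\in(0,1/2)$ let $C_{sa}=\frac{21C_x(1+2C_x)(\sqrt{C_0}+1)}{\tilde c}\log\frac2\delta$, $K=\Big\lfloor\log_q\frac{C_{sa}}{q_0\sqrt{|D|_\gamma}}\Big\rfloor$ and $\lambda_k=q_0q^k$. Run through $k=K,K-1,\dots,1$ until for the first time $$\big\|(\widehat\Sigma_D+\lambda_{k+1}I)^{1/2}(\theta_{D,\lambda_{k+1}}-\theta_{D,\lambda_k})\big\|_2\ \ge\ 168\,b\sqrt{\tfrac{1-\tilde c}{1-2\tilde c}}\sqrt{\tfrac1{1-2\tilde c}}\,M(1+C_x)\,\mathcal W_{D,\lambda_{k+1}}\log^2\tfrac2\delta ,$$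 and let $\hat k=k+1$ for this $k$, so that the strict reverse inequality holds for every $k$ with $\hat k\le k\le K$; if the inequality holds for no such $k$, let $\hat k=K$. **Theorem.** There is a constant $C_2>0$, independent of $|D|$ and $\delta$, such that for every $\delta\in(0,1/2)$ and every sample size with $K\ge1$, with probability at least $1-\delta$, $$\big\|\Sigma^{1/2}(\theta_{D,\lambda_{\hat k}}-\theta^*)\big\|_2\le C_2\,|D|_\gamma^{-\frac{r+1/2}{2r+s+1}}(\log d)^{\frac2{\gamma_0}}\log^2\tfrac2\delta\;\log_q\!\big(|D|_\gamma^{-1/2}\big)\Big(1+\big(\log\tfrac2\delta\big)^{\min\{1,r\}}\mathbb I_{r>1/2}\Big).$$ More precisely, if $2r+s\ge1$, then $C_2$ depends only on the constants and the filter fixed above ($d,C_x,M,C,r,s,C_0,b_0,c_0,\gamma_0,\tilde c,q,q_0$ and $g,b,\nu_g,(\gamma_\nu)$), and not otherwise on the law of $(z_i)_i$ or on $\theta^*$; if $2r+s<1$, then $C_2$ depends in addition only on a positive lower bound for the positive eigenvalues of $\Sigma$. -/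

import Mathlib

open MeasureTheory

universe u

noncomputable section

namespace SpectralRegression

/-- Feature vectors: `ℝ^d` with the Euclidean norm. -/
abbrev Feat (d : ℕ) : Type := EuclideanSpace ℝ (Fin d)

/-- An observation `(x, y)`. -/
abbrev Obs (d : ℕ) : Type := Feat d × ℝ

/-! ### Linear algebra -/

/-- A matrix acting on a Euclidean vector. -/
def act {d : ℕ} (A : Matrix (Fin d) (Fin d) ℝ) (v : Feat d) : Feat d :=
  WithLp.toLp 2 (A.mulVec v.ofLp)

/-- The spectral function `φ(A)` of a symmetric matrix: `φ` applied to the eigenvalues. -/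
def specFun {d : ℕ} (φ : ℝ → ℝ) (A : Matrix (Fin d) (Fin d) ℝ) : Matrix (Fin d) (Fin d) ℝ :=
  cfc φ A

/-- The power `A ^ p` of a positive semidefinite matrix (used for `p > 0`). -/
def matPow {d : ℕ} (A : Matrix (Fin d) (Fin d) ℝ) (p : ℝ) : Matrix (Fin d) (Fin d) ℝ :=
  specFun (fun t => t ^ p) A

/-- `A + lam I`. -/
def shift {d : ℕ} (A : Matrix (Fin d) (Fin d) ℝ) (lam : ℝ) : Matrix (Fin d) (Fin d) ℝ :=
  A + lam • (1 : Matrix (Fin d) (Fin d) ℝ)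

/-- `Tr (A (A + lam I)⁻¹)`. -/
def effDim {d : ℕ} (A : Matrix (Fin d) (Fin d) ℝ) (lam : ℝ) : ℝ :=
  (A * (shift A lam)⁻¹).trace

/-! ### Population and sample quantities -/

/-- The covariance matrix `E[X Xᵀ]` of a law `P` of `(X, Y)`. -/
def popCov {d : ℕ} (P : Measure (Obs d)) : Matrix (Fin d) (Fin d) ℝ :=
  Matrix.of fun a b => ∫ w, w.1 a * w.1 b ∂P

/-- The empirical covariance matrix `(1/n) ∑ xᵢ xᵢᵀ`. -/
def empCov {d n : ℕ} (D : Fin n → Obs d) : Matrix (Fin d) (Fin d) ℝ :=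
  (1 / (n : ℝ)) • ∑ i, Matrix.vecMulVec (D i).1.ofLp (D i).1.ofLp

/-- The empirical mean `(1/n) ∑ yᵢ xᵢ` of `XY`. -/
def empCross {d n : ℕ} (D : Fin n → Obs d) : Feat d :=
  (1 / (n : ℝ)) • ∑ i, (D i).2 • (D i).1

/-- The spectral estimator `g_lam(Σ̂_D) Ê_D[XY]`. -/
def estimator {d n : ℕ} (g : ℝ → ℝ → ℝ) (D : Fin n → Obs d) (lam : ℝ) : Feat d :=
  act (specFun (g lam) (empCov D)) (empCross D)

/-! ### Filter functions -/

/-- `g` is a family of filter functions on `[0, Cx ^ 2]`, `0 < lam ≤ Cx ^ 2`, with bound `b`,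
qualification `qual` (possibly infinite) and constants `gam`. -/
def IsFilter (Cx b : ℝ) (qual : EReal) (gam : ℝ → ℝ) (g : ℝ → ℝ → ℝ) : Prop :=
  0 < b ∧ ((1 / 2 : ℝ) : EReal) ≤ qual ∧ (∀ ν, 0 < gam ν) ∧
    ∀ lam, 0 < lam → lam ≤ Cx ^ 2 → ∀ σ, 0 < σ → σ ≤ Cx ^ 2 →
      |g lam σ| ≤ b / lam ∧ |g lam σ * σ| ≤ b ∧
        ∀ ν : ℝ, 0 < ν → (ν : EReal) ≤ qual → |1 - g lam σ * σ| * σ ^ ν ≤ gam ν * lam ^ ν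

/-! ### Mixing -/

/-- Bounded functions on the observation space that are 1-Lipschitz for the Euclidean norm of
`ℝ^d × ℝ = ℝ^(d+1)`. -/
def lipBall (d : ℕ) : Set (Obs d → ℝ) :=
  {f | (∃ B, ∀ w, |f w| ≤ B) ∧
    ∀ w w', |f w - f w'| ≤ Real.sqrt (‖w.1 - w'.1‖ ^ 2 + (w.2 - w'.2) ^ 2)}

/-- The sigma-algebra generated by the observations with indices `0, …, i`. -/
abbrev past {Ω : Type*} {d : ℕ} (z : ℕ → Ω → Obs d) (i : ℕ) : MeasurableSpace Ω :=
  ⨆ l ∈ Set.Iic i, MeasurableSpace.comap (z l) inferInstance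

/-- The mixing coefficient `τ_j`, the supremum over `i` and over `f` of
`‖E(f(z_{i+j}) | z_0, …, z_i) - E f(z_{i+j})‖_∞`. -/
def tauCoeff {Ω : Type*} [MeasurableSpace Ω] {d : ℕ} (μ : Measure Ω) (z : ℕ → Ω → Obs d)
    (j : ℕ) : ENNReal :=
  ⨆ (i : ℕ) (f ∈ lipBall d),
    eLpNorm (fun ω => (μ[fun ω' => f (z (i + j) ω') | past z i]) ω - ∫ ω', f (z (i + j) ω') ∂μ)
      ⊤ μ

/-- Geometric `τ`-mixing with constants `b0, c0, γ0`. -/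
def IsGeomTauMixing {Ω : Type*} [MeasurableSpace Ω] {d : ℕ} (μ : Measure Ω)
    (z : ℕ → Ω → Obs d) (b0 c0 γ0 : ℝ) : Prop :=
  ∀ j : ℕ, 1 ≤ j → tauCoeff μ z j ≤ ENNReal.ofReal (c0 * Real.exp (-(b0 * j) ^ γ0))

/-! ### Effective sample sizes -/

/-- The effective sample size `|D|_γ` of a sample of size `n`; `t` is the norm of the target. -/
def effSize (b0 c0 γ0 Cx M t : ℝ) (n : ℕ) : ℝ :=
  (n * b0) /
    (2 * (max 1 (Real.log
      (c0 * b0 * max (Real.sqrt 2 * max (M + 2 * Cx * t) Cx / (2 * Cx * M)) (1 / Cx) * n)))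
        ^ (1 / γ0))

/-- The second effective sample size `ℓ₃`. -/
def ellThree (b0 c0 γ0 Cx : ℝ) (d n : ℕ) : ℝ :=
  (n * b0) /
    (2 * (max 1 (Real.log (b0 * c0 * n * (2 * Real.sqrt d / Cx)))) ^ (1 / γ0))

/-! ### The adaptive choice of the regularization parameter -/

/-- The constant `C_sa`. -/
def constSa (Cx C0 ct δ : ℝ) : ℝ :=
  21 * Cx * (1 + 2 * Cx) * (Real.sqrt C0 + 1) / ct * Real.log (2 / δ)

/-- The number of grid points `log_q (C_sa / (q0 √N))`, rounded down. -/
def gridSize (q q0 csa N : ℝ) : ℕ :=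
  ⌊Real.logb q (csa / (q0 * Real.sqrt N))⌋₊

/-- The grid `q0 q ^ k`. -/
def gridPt (q q0 : ℝ) (k : ℕ) : ℝ := q0 * q ^ k

/-- `W_{D, lam}`, with `N = |D|_γ` and `ell = ℓ₃`. -/
def wTerm {d n : ℕ} (Cx N ell : ℝ) (D : Fin n → Obs d) (lam : ℝ) : ℝ :=
  (1 + 4 * (13 * Cx / Real.sqrt (lam * ell) + 21 * Cx ^ 2 / (lam * ell)))
      * max (Real.sqrt (effDim (empCov D) lam)) 1 / Real.sqrt N
    + 1 / (N * Real.sqrt lam)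

/-- The stopping inequality of the rule at the grid index `k`: consecutive estimators differ by at
least the threshold. -/
def Exceeds {d n : ℕ} (g : ℝ → ℝ → ℝ) (b ct Cx M δ q q0 N ell : ℝ) (D : Fin n → Obs d)
    (k : ℕ) : Prop :=
  168 * b * Real.sqrt ((1 - ct) / (1 - 2 * ct)) * Real.sqrt (1 / (1 - 2 * ct)) * M * (1 + Cx)
      * wTerm Cx N ell D (gridPt q q0 (k + 1)) * Real.log (2 / δ) ^ 2
    ≤ ‖act (matPow (shift (empCov D) (gridPt q q0 (k + 1))) (1 / 2))
        (estimator g D (gridPt q q0 (k + 1)) - estimator g D (gridPt q q0 k))‖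

open Classical in
/-- The first index met in the order `K, K - 1, …, 1` at which the stopping inequality holds, and
`0` if there is none. -/
def firstExceed {d n : ℕ} (g : ℝ → ℝ → ℝ) (b ct Cx M δ q q0 N ell : ℝ) (K : ℕ)
    (D : Fin n → Obs d) : ℕ :=
  Nat.findGreatest (fun k => 1 ≤ k ∧ Exceeds g b ct Cx M δ q q0 N ell D k) K

/-- The selected index: the last one visited before the stopping inequality first holds on the way
down `K, K - 1, …, 1` (so the inequality fails at every `k` with `kHat ≤ k ≤ K`); it is `K` if the
inequality never holds. -/
def kHat {d n : ℕ} (g : ℝ → ℝ → ℝ) (b ct Cx M δ q q0 N ell : ℝ) (K : ℕ)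
    (D : Fin n → Obs d) : ℕ :=
  if firstExceed g b ct Cx M δ q q0 N ell K D = 0 then K
  else firstExceed g b ct Cx M δ q q0 N ell K D + 1

/-- The adaptive estimator `θ_{D, lam_kHat}`, for a target of norm `t`. -/
def adaptiveEstimator {d n : ℕ} (g : ℝ → ℝ → ℝ) (b ct Cx M C0 b0 c0 γ0 δ q q0 t : ℝ)
    (D : Fin n → Obs d) : Feat d :=
  estimator g D (gridPt q q0
    (kHat g b ct Cx M δ q q0 (effSize b0 c0 γ0 Cx M t n) (ellThree b0 c0 γ0 Cx d n)
      (gridSize q q0 (constSa Cx C0 ct δ) (effSize b0 c0 γ0 Cx M t n)) D))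

end SpectralRegression

end

/-!
The constant of the bound may depend on the dimension `d`, and this decides the argument. In
dimension `d` the variance of a spectral estimator whose parameter `lam` lies on the grid is of
order `d / N`, with `N` the effective sample size, whatever the effective dimension is: every
parameter on the grid is at least of order `log (2 / δ) / √N`, which is the precision of the
empirical covariance. The same holds for the squared thresholds of the selection rule (`effDim_le`,
`wTerm_le`). The rate is never faster than `N ^ (-1/2)`, so that variances and thresholds are
always affordable, and the only question is the bias.

The rule starts at the smallest parameter `lam_K` and moves to larger ones. Between `lam_K` and the
selected parameter all consecutive differences stay below the threshold; their number is at most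
`K`, of order `log_q (N ^ (-1/2))`, which is the logarithmic factor of the bound
(`norm_selected_sub_le`, `le_mul_logb`). Hence the error of the selected estimator is at most the
error at `lam_K` (or at `lam_{K+1}`, if the rule stops at once) plus `K` thresholds. At these
parameters the bias is of order `lam ^ p` with `p = (2 r + 1) / (2 r + s + 1)`: this exponent lies
in `[1/2, 1]`, is covered by the qualification, and is at most `r + 1/2` exactly when `2 r + s ≥ 1`.
Otherwise the lower bound on the positive eigenvalues turns the source condition into one of the
order needed (`abs_inner_le_of_source`). As `lam` is of order `log (2 / δ) / √N`, the bias is of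
order `N ^ (-p/2)`, the claimed rate.

The error at a fixed parameter (`norm_half_estimator_sub_le`) is computed in the eigenbases of
`Σ` and `Σ̂`. It needs `Σ + lam ≤ (1 + B) (Σ̂ + lam)` and a bound on the noise relative to
`(Σ + lam)^{1/2}`, which hold outside an event of probability `δ` (`exists_deviation_const`) by a
union bound over `d ^ 2` covariance entries and `d` eigendirections of `Σ`. Each of these is a
scalar Bernstein inequality (`measure_mean_ge_le`): the sample is split into `k` residue classes
modulo a gap `k` of order `(log n) ^ (1 / γ0)`; inside one class the exponential moment is a product
up to the mixing error, because the exponential of a bounded Lipschitz function is again bounded and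
Lipschitz, and the classes are combined by convexity.
-/

namespace SpectralRegression

/-! ### Spectral calculus in an eigenbasis -/

theorem act_add {d : ℕ} (A : Matrix (Fin d) (Fin d) ℝ) (u v : Feat d) :
    act A (u + v) = act A u + act A v := by
  ext i
  simp [act, Matrix.mulVec_add]

theorem act_sub {d : ℕ} (A : Matrix (Fin d) (Fin d) ℝ) (u v : Feat d) :
    act A (u - v) = act A u - act A v := by
  ext i
  simp [act, Matrix.mulVec_sub]

theorem act_smul {d : ℕ} (A : Matrix (Fin d) (Fin d) ℝ) (c : ℝ) (v : Feat d) :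
    act A (c • v) = c • act A v := by
  ext i
  simp [act, Matrix.mulVec_smul]

theorem sub_act {d : ℕ} (A B : Matrix (Fin d) (Fin d) ℝ) (v : Feat d) :
    act (A - B) v = act A v - act B v := by
  ext i
  simp [act, Matrix.sub_mulVec]

theorem act_shift {d : ℕ} (A : Matrix (Fin d) (Fin d) ℝ) (lam : ℝ) (v : Feat d) :
    act (shift A lam) v = act A v + lam • v := by
  ext i
  simp [act, shift, Matrix.add_mulVec, Matrix.smul_mulVec]

theorem inner_act_eq_sum {d : ℕ} (A : Matrix (Fin d) (Fin d) ℝ) (u v : Feat d) :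
    inner ℝ u (act A v) = ∑ a, ∑ b, u a * A a b * v b := by
  simp [act, PiLp.inner_apply, Matrix.mulVec, dotProduct, Finset.sum_mul]
  refine Finset.sum_congr rfl fun a _ => Finset.sum_congr rfl fun b _ => by ring

theorem inner_act_comm {d : ℕ} {A : Matrix (Fin d) (Fin d) ℝ} (hA : A.IsHermitian)
    (u v : Feat d) : inner ℝ (act A u) v = inner ℝ u (act A v) := by
  rw [real_inner_comm, inner_act_eq_sum, inner_act_eq_sum, Finset.sum_comm]
  refine Finset.sum_congr rfl fun a _ => Finset.sum_congr rfl fun b _ => ?_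
  have : A b a = A a b := by simpa using hA.apply a b
  rw [this]; ring

theorem act_specFun_eigenvectorBasis {d : ℕ} {A : Matrix (Fin d) (Fin d) ℝ}
    (hA : A.IsHermitian) (φ : ℝ → ℝ) (j : Fin d) :
    act (specFun φ A) (hA.eigenvectorBasis j)
      = φ (hA.eigenvalues j) • hA.eigenvectorBasis j := by
  rw [act, specFun, hA.cfc_eq, Matrix.IsHermitian.cfc, Unitary.conjStarAlgAut_apply,
    ← Matrix.mulVec_mulVec, ← Matrix.mulVec_mulVec, hA.star_eigenvectorUnitary_mulVec]
  ext i
  simp [Matrix.mulVec_single, mul_comm]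

theorem act_eigenvectorBasis {d : ℕ} {A : Matrix (Fin d) (Fin d) ℝ}
    (hA : A.IsHermitian) (j : Fin d) :
    act A (hA.eigenvectorBasis j) = hA.eigenvalues j • hA.eigenvectorBasis j := by
  ext i
  simp [act, hA.mulVec_eigenvectorBasis]

theorem isHermitian_specFun {d : ℕ} (A : Matrix (Fin d) (Fin d) ℝ) (φ : ℝ → ℝ) :
    (specFun φ A).IsHermitian :=
  cfc_predicate φ A

theorem inner_eigenvectorBasis_specFun {d : ℕ} {A : Matrix (Fin d) (Fin d) ℝ}
    (hA : A.IsHermitian) (φ : ℝ → ℝ) (j : Fin d) (v : Feat d) :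
    inner ℝ (hA.eigenvectorBasis j) (act (specFun φ A) v)
      = φ (hA.eigenvalues j) * inner ℝ (hA.eigenvectorBasis j) v := by
  rw [← inner_act_comm (isHermitian_specFun A φ), act_specFun_eigenvectorBasis hA,
    real_inner_smul_left]

theorem inner_eigenvectorBasis_act {d : ℕ} {A : Matrix (Fin d) (Fin d) ℝ}
    (hA : A.IsHermitian) (j : Fin d) (v : Feat d) :
    inner ℝ (hA.eigenvectorBasis j) (act A v)
      = hA.eigenvalues j * inner ℝ (hA.eigenvectorBasis j) v := by
  rw [← inner_act_comm hA, act_eigenvectorBasis hA, real_inner_smul_left]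

theorem norm_sq_eq_sum {d : ℕ} (e : OrthonormalBasis (Fin d) ℝ (Feat d)) (v : Feat d) :
    ‖v‖ ^ 2 = ∑ j, inner ℝ (e j) v ^ 2 := by
  rw [← e.sum_sq_norm_inner_right v]
  simp

theorem inner_eq_sum {d : ℕ} (e : OrthonormalBasis (Fin d) ℝ (Feat d)) (u v : Feat d) :
    inner ℝ u v = ∑ j, inner ℝ (e j) u * inner ℝ (e j) v := by
  rw [← e.sum_inner_mul_inner u v]
  exact Finset.sum_congr rfl fun j _ => by rw [real_inner_comm]

theorem inner_act_self_eq_sum {d : ℕ} {A : Matrix (Fin d) (Fin d) ℝ}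
    (hA : A.IsHermitian) (v : Feat d) :
    inner ℝ v (act A v)
      = ∑ j, hA.eigenvalues j * inner ℝ (hA.eigenvectorBasis j) v ^ 2 := by
  rw [inner_eq_sum hA.eigenvectorBasis]
  refine Finset.sum_congr rfl fun j _ => ?_
  rw [inner_eigenvectorBasis_act]; ring

theorem norm_act_matPow_half_sq {d : ℕ} {A : Matrix (Fin d) (Fin d) ℝ}
    (hA : A.PosSemidef) (v : Feat d) :
    ‖act (matPow A (1 / 2)) v‖ ^ 2 = inner ℝ v (act A v) := by
  rw [norm_sq_eq_sum hA.1.eigenvectorBasis, inner_act_self_eq_sum hA.1]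
  refine Finset.sum_congr rfl fun j _ => ?_
  rw [matPow, inner_eigenvectorBasis_specFun, mul_pow, ← Real.sqrt_eq_rpow,
    Real.sq_sqrt (hA.eigenvalues_nonneg j)]

theorem posDef_shift {d : ℕ} {A : Matrix (Fin d) (Fin d) ℝ} (hA : A.PosSemidef) {lam : ℝ}
    (hlam : 0 < lam) : (shift A lam).PosDef :=
  Matrix.PosDef.posSemidef_add hA (Matrix.PosDef.one.smul hlam)

theorem norm_act_shift_half_sq {d : ℕ} {A : Matrix (Fin d) (Fin d) ℝ}
    (hA : A.PosSemidef) {lam : ℝ} (hlam : 0 < lam) (v : Feat d) :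
    ‖act (matPow (shift A lam) (1 / 2)) v‖ ^ 2 = inner ℝ v (act A v) + lam * ‖v‖ ^ 2 := by
  rw [norm_act_matPow_half_sq (posDef_shift hA hlam).posSemidef, act_shift, inner_add_right,
    real_inner_smul_right, real_inner_self_eq_norm_sq]

/-- The effective dimension never exceeds the ambient dimension. -/
theorem effDim_le {d : ℕ} {A : Matrix (Fin d) (Fin d) ℝ} (hA : A.PosSemidef) {lam : ℝ}
    (hlam : 0 < lam) : effDim A lam ≤ d := by
  have hp := posDef_shift hA hlam
  have hinv : shift A lam * (shift A lam)⁻¹ = 1 :=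
    Matrix.mul_nonsing_inv _ ((Matrix.isUnit_iff_isUnit_det _).1 hp.isUnit)
  have hA' : A = shift A lam - lam • (1 : Matrix (Fin d) (Fin d) ℝ) := by simp [shift]
  have htr : 0 ≤ (shift A lam)⁻¹.trace := hp.inv.posSemidef.trace_nonneg
  have : effDim A lam = d - lam * (shift A lam)⁻¹.trace := by
    rw [effDim]
    nth_rewrite 1 [hA']
    rw [sub_mul, hinv, Matrix.trace_sub]
    simp
  rw [this]
  nlinarith

theorem posSemidef_of_inner_act_nonneg {d : ℕ} {A : Matrix (Fin d) (Fin d) ℝ}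
    (hA : A.IsHermitian) (h : ∀ v, 0 ≤ inner ℝ v (act A v)) : A.PosSemidef := by
  refine hA.posSemidef_iff_eigenvalues_nonneg.2 fun j => ?_
  have := h (hA.eigenvectorBasis j)
  rw [act_eigenvectorBasis hA, real_inner_smul_right, real_inner_self_eq_norm_sq] at this
  simpa using this

theorem eigenvalues_le_of_inner_act_le {d : ℕ} {A : Matrix (Fin d) (Fin d) ℝ}
    (hA : A.IsHermitian) {c : ℝ} (h : ∀ v, inner ℝ v (act A v) ≤ c * ‖v‖ ^ 2) (j : Fin d) :
    hA.eigenvalues j ≤ c := by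
  have := h (hA.eigenvectorBasis j)
  rw [act_eigenvectorBasis hA, real_inner_smul_right, real_inner_self_eq_norm_sq] at this
  simpa using this

/-! ### The error of the estimator on a fixed sample -/

theorem isHermitian_empCov {d n : ℕ} (D : Fin n → Obs d) : (empCov D).IsHermitian := by
  ext a b
  simp [empCov, Matrix.sum_apply, Matrix.vecMulVec_apply, mul_comm]

theorem act_empCov {d n : ℕ} (D : Fin n → Obs d) (v : Feat d) :
    act (empCov D) v = (1 / (n : ℝ)) • ∑ i, inner ℝ (D i).1 v • (D i).1 := by
  ext a
  simp only [act, empCov, Matrix.smul_mulVec, Matrix.sum_mulVec, Matrix.vecMulVec_mulVec]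
  simp [PiLp.inner_apply, dotProduct, mul_comm]

theorem inner_empCov {d n : ℕ} (D : Fin n → Obs d) (u v : Feat d) :
    inner ℝ u (act (empCov D) v)
      = (1 / (n : ℝ)) * ∑ i, inner ℝ (D i).1 u * inner ℝ (D i).1 v := by
  rw [act_empCov, real_inner_smul_right, inner_sum]
  congr 1
  refine Finset.sum_congr rfl fun i _ => ?_
  rw [real_inner_smul_right, real_inner_comm u]; ring

theorem inner_empCross {d n : ℕ} (D : Fin n → Obs d) (v : Feat d) :
    inner ℝ (empCross D) v = (1 / (n : ℝ)) * ∑ i, (D i).2 * inner ℝ (D i).1 v := by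
  simp [empCross, real_inner_smul_left, sum_inner]

theorem posSemidef_empCov {d n : ℕ} (D : Fin n → Obs d) : (empCov D).PosSemidef := by
  refine posSemidef_of_inner_act_nonneg (isHermitian_empCov D) fun v => ?_
  rw [inner_empCov]
  exact mul_nonneg (by positivity) (Finset.sum_nonneg fun i _ => mul_self_nonneg _)

theorem eigenvalues_empCov_le {d n : ℕ} {D : Fin n → Obs d} {Cx : ℝ}
    (hD : ∀ i, ‖(D i).1‖ ≤ Cx) (j : Fin d) :
    (isHermitian_empCov D).eigenvalues j ≤ Cx ^ 2 := by
  refine eigenvalues_le_of_inner_act_le _ (fun v => ?_) j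
  rw [inner_empCov]
  have h1 : ∑ i, inner ℝ (D i).1 v * inner ℝ (D i).1 v ≤ ∑ _i : Fin n, Cx ^ 2 * ‖v‖ ^ 2 := by
    refine Finset.sum_le_sum fun i _ => ?_
    rw [← sq, ← mul_pow, ← sq_abs]
    refine pow_le_pow_left₀ (abs_nonneg _) ((abs_real_inner_le_norm _ _).trans ?_) 2
    exact mul_le_mul_of_nonneg_right (hD i) (norm_nonneg _)
  rcases Nat.eq_zero_or_pos n with rfl | hn
  · simp; positivity
  · have hn' : (0 : ℝ) < n := by exact_mod_cast hn
    calc _ ≤ (1 / (n : ℝ)) * ∑ _i : Fin n, Cx ^ 2 * ‖v‖ ^ 2 := by gcongr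
      _ = Cx ^ 2 * ‖v‖ ^ 2 := by simp; field_simp

/-- The vectors `xᵢ` are orthogonal to the kernel of the empirical covariance. Hence the value of
a filter at `0`, which is unconstrained, does not matter. -/
theorem inner_eq_zero_of_empCov {d n : ℕ} (D : Fin n → Obs d) (v : Feat d)
    (hv : inner ℝ v (act (empCov D) v) = 0) (i : Fin n) : inner ℝ (D i).1 v = 0 := by
  rw [inner_empCov] at hv
  have hn : (n : ℝ) ≠ 0 := by
    have := i.pos
    positivity
  have h := (mul_eq_zero.1 hv).resolve_left (by positivity)
  rw [Finset.sum_eq_zero_iff_of_nonneg fun _ _ => mul_self_nonneg _] at h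
  exact mul_self_eq_zero.1 (h i (Finset.mem_univ i))

/-- The squared norm `‖(A + lam)^{1/2} φ(A) v‖²` in the eigenbasis of `A`. -/
theorem energy_specFun {d : ℕ} {A : Matrix (Fin d) (Fin d) ℝ} (hA : A.IsHermitian) (lam : ℝ)
    (φ : ℝ → ℝ) (v : Feat d) :
    inner ℝ (act (specFun φ A) v) (act A (act (specFun φ A) v))
        + lam * ‖act (specFun φ A) v‖ ^ 2
      = ∑ j, (hA.eigenvalues j + lam)
          * (φ (hA.eigenvalues j) ^ 2 * inner ℝ (hA.eigenvectorBasis j) v ^ 2) := by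
  rw [inner_act_self_eq_sum hA, norm_sq_eq_sum hA.eigenvectorBasis, Finset.mul_sum,
    ← Finset.sum_add_distrib]
  refine Finset.sum_congr rfl fun j _ => ?_
  rw [inner_eigenvectorBasis_specFun]; ring

/-- The noise term. The bound `hξ` on `⟨ξ, u⟩` is the dual form of a bound on
`‖(S + lam)^{-1/2} ξ‖`; it is tested on `u = (A + lam) g(A)² ξ`. -/
theorem energy_noise_le {d : ℕ} {A S : Matrix (Fin d) (Fin d) ℝ} (hA : A.PosSemidef)
    {lam B Q c : ℝ} (hlam : 0 < lam) (hB : 0 ≤ B)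
    (hAS : ∀ v, inner ℝ v (act S v) + lam * ‖v‖ ^ 2
      ≤ (1 + B) * (inner ℝ v (act A v) + lam * ‖v‖ ^ 2))
    (g : ℝ → ℝ) (ξ : Feat d)
    (hg : ∀ j, 0 < hA.1.eigenvalues j →
      |g (hA.1.eigenvalues j)| * (hA.1.eigenvalues j + lam) ≤ c)
    (h0 : ∀ j, hA.1.eigenvalues j = 0 → inner ℝ (hA.1.eigenvectorBasis j) ξ = 0)
    (hξ : ∀ u, inner ℝ ξ u ^ 2 ≤ Q ^ 2 * (inner ℝ u (act S u) + lam * ‖u‖ ^ 2)) :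
    inner ℝ (act (specFun g A) ξ) (act A (act (specFun g A) ξ))
        + lam * ‖act (specFun g A) ξ‖ ^ 2 ≤ c ^ 2 * Q ^ 2 * (1 + B) := by
  set X := inner ℝ (act (specFun g A) ξ) (act A (act (specFun g A) ξ))
        + lam * ‖act (specFun g A) ξ‖ ^ 2 with hX
  set a := hA.1.eigenvalues with ha
  set e := hA.1.eigenvectorBasis with he
  have hXs : X = ∑ j, (a j + lam) * (g (a j) ^ 2 * inner ℝ (e j) ξ ^ 2) :=
    energy_specFun hA.1 lam g ξ
  set u := act (specFun (fun t => (t + lam) * g t ^ 2) A) ξ with hu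
  have hXu : inner ℝ ξ u = X := by
    rw [inner_eq_sum e, hXs]
    refine Finset.sum_congr rfl fun j _ => ?_
    rw [hu, inner_eigenvectorBasis_specFun hA.1]; ring
  have hpos : ∀ j, 0 ≤ a j := hA.eigenvalues_nonneg
  have hEu : inner ℝ u (act A u) + lam * ‖u‖ ^ 2 ≤ c ^ 2 * X := by
    rw [hu, energy_specFun hA.1, hXs, Finset.mul_sum]
    refine Finset.sum_le_sum fun j _ => ?_
    change (a j + lam) * (((a j + lam) * g (a j) ^ 2) ^ 2 * inner ℝ (e j) ξ ^ 2)
      ≤ c ^ 2 * ((a j + lam) * (g (a j) ^ 2 * inner ℝ (e j) ξ ^ 2))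
    rcases (hpos j).eq_or_lt with h | h
    · have := h0 j h.symm
      change inner ℝ (e j) ξ = 0 at this
      rw [this]; simp
    · have h1 : (|g (a j)| * (a j + lam)) ^ 2 ≤ c ^ 2 :=
        pow_le_pow_left₀ (by have := hpos j; positivity) (hg j h) 2
      rw [mul_pow, sq_abs] at h1
      have h2 : 0 ≤ (a j + lam) * (g (a j) ^ 2 * inner ℝ (e j) ξ ^ 2) := by
        have := hpos j; positivity
      nlinarith [mul_le_mul_of_nonneg_right h1 h2]
  have hX0 : 0 ≤ X := by
    rw [hXs]
    exact Finset.sum_nonneg fun j _ => by have := hpos j; positivity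
  have h1 := hξ u
  rw [hXu] at h1
  have h2 := hAS u
  have h3 : X * X ≤ c ^ 2 * Q ^ 2 * (1 + B) * X := by
    calc X * X = X ^ 2 := (sq X).symm
      _ ≤ Q ^ 2 * (inner ℝ u (act S u) + lam * ‖u‖ ^ 2) := h1
      _ ≤ Q ^ 2 * ((1 + B) * (c ^ 2 * X)) := by gcongr; exact h2.trans (by gcongr)
      _ = _ := by ring
  rcases hX0.eq_or_lt with h | h
  · rw [← h]; positivity
  · exact le_of_mul_le_mul_right h3 h

/-- The bias along one eigenvector `f` of `S`, for a residual `ψ` of qualification `p ≤ 1`.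
Since `2 p - 1 ≤ 1`, the interpolation `x^{-(2p-1)} ≤ T^{-(2p-1)} (1 + T / x)` reduces the source
condition of `S` on `f` to a bound on `⟨f, (A + lam)⁻¹ f⟩`; operator monotonicity of powers is not
needed. -/
theorem energy_bias_le {d : ℕ} {A S : Matrix (Fin d) (Fin d) ℝ} (hA : A.PosSemidef)
    (hS : S.PosSemidef) {lam B p c : ℝ} (hlam : 0 < lam) (hB : 0 ≤ B)
    (hAS : ∀ v, inner ℝ v (act S v) + lam * ‖v‖ ^ 2
      ≤ (1 + B) * (inner ℝ v (act A v) + lam * ‖v‖ ^ 2))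
    (hp0 : 1 / 2 ≤ p) (hp1 : p ≤ 1) (ψ : ℝ → ℝ)
    (hψ : ∀ j, |ψ (hA.1.eigenvalues j)| * (hA.1.eigenvalues j + lam) ^ p ≤ c) (l : Fin d) :
    hS.1.eigenvalues l ^ (2 * p - 1)
        * (inner ℝ (act (specFun ψ A) (hS.1.eigenvectorBasis l))
            (act A (act (specFun ψ A) (hS.1.eigenvectorBasis l)))
          + lam * ‖act (specFun ψ A) (hS.1.eigenvectorBasis l)‖ ^ 2)
      ≤ 2 * c ^ 2 * (1 + B) := by
  set a := hA.1.eigenvalues with ha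
  set e := hA.1.eigenvectorBasis with he
  set f := hS.1.eigenvectorBasis l with hf
  set σ := hS.1.eigenvalues l with hσ
  have hσ0 : 0 ≤ σ := hS.eigenvalues_nonneg l
  have hpos : ∀ j, 0 < a j + lam := fun j =>
    add_pos_of_nonneg_of_pos (hA.eigenvalues_nonneg j) hlam
  -- `t = ⟨f, (A + lam)⁻¹ f⟩`; it is bounded by testing `hAS` on `u = (A + lam)⁻¹ f`
  set t := ∑ j, (a j + lam)⁻¹ * inner ℝ (e j) f ^ 2 with ht
  have hf1 : ∑ j, inner ℝ (e j) f ^ 2 = 1 := by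
    rw [← norm_sq_eq_sum, hf]; simp
  have ht0 : 0 ≤ t := Finset.sum_nonneg fun j _ => by have := hpos j; positivity
  set u := act (specFun (fun x => (x + lam)⁻¹) A) f with hu
  have hfu : inner ℝ f u = t := by
    rw [inner_eq_sum e, ht]
    refine Finset.sum_congr rfl fun j _ => ?_
    rw [hu, inner_eigenvectorBasis_specFun hA.1]; ring
  have hEu : inner ℝ u (act A u) + lam * ‖u‖ ^ 2 = t := by
    rw [hu, energy_specFun hA.1, ht]
    refine Finset.sum_congr rfl fun j _ => ?_
    change (a j + lam) * ((a j + lam)⁻¹ ^ 2 * inner ℝ (e j) f ^ 2)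
      = (a j + lam)⁻¹ * inner ℝ (e j) f ^ 2
    have := (hpos j).ne'
    field_simp
  have hSu : (σ + lam) * t ^ 2 ≤ inner ℝ u (act S u) + lam * ‖u‖ ^ 2 := by
    rw [inner_act_self_eq_sum hS.1, norm_sq_eq_sum hS.1.eigenvectorBasis, Finset.mul_sum,
      ← Finset.sum_add_distrib, ← hfu]
    refine le_trans (le_of_eq ?_) (Finset.single_le_sum (fun j _ => ?_) (Finset.mem_univ l))
    · ring
    · have := hS.eigenvalues_nonneg j
      positivity
  have hσt : (σ + lam) * t ≤ 1 + B := by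
    have h := hSu.trans ((hAS u).trans_eq (by rw [hEu]))
    rcases ht0.eq_or_lt with h0 | h0
    · rw [← h0]; linarith
    · refine le_of_mul_le_mul_right (a := t) ?_ h0
      linarith
  set T := (σ + lam) / (1 + B) with hT
  have hT0 : 0 < T := by positivity
  have hTt : T * t ≤ 1 := by
    rw [hT, div_mul_eq_mul_div, div_le_one (by linarith)]; exact hσt
  set β := 2 * p - 1 with hβ
  have hβ0 : 0 ≤ β := by rw [hβ]; linarith
  have hβ1 : β ≤ 1 := by rw [hβ]; linarith
  have hx : ∀ x : ℝ, 0 < x → T ^ β * x ^ (-β) ≤ 1 + T * x⁻¹ := by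
    intro x hx
    have h1 : T ^ β * x ^ (-β) = (T * x⁻¹) ^ β := by
      rw [Real.mul_rpow hT0.le (by positivity), Real.rpow_neg hx.le, Real.inv_rpow hx.le]
    rw [h1]
    have h2 : 0 ≤ T * x⁻¹ := by positivity
    rcases le_total (T * x⁻¹) 1 with h | h
    · linarith [Real.rpow_le_one h2 h hβ0]
    · have := Real.rpow_le_rpow_of_exponent_le h hβ1
      rw [Real.rpow_one] at this
      linarith
  have hE : T ^ β * (inner ℝ (act (specFun ψ A) f) (act A (act (specFun ψ A) f))
        + lam * ‖act (specFun ψ A) f‖ ^ 2) ≤ 2 * c ^ 2 := by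
    rw [energy_specFun hA.1, Finset.mul_sum]
    calc _ ≤ ∑ j, c ^ 2 * (inner ℝ (e j) f ^ 2 + T * ((a j + lam)⁻¹ * inner ℝ (e j) f ^ 2)) := by
          refine Finset.sum_le_sum fun j _ => ?_
          change T ^ β * ((a j + lam) * (ψ (a j) ^ 2 * inner ℝ (e j) f ^ 2)) ≤ _
          have h1 : (|ψ (a j)| * (a j + lam) ^ p) ^ 2 ≤ c ^ 2 :=
            pow_le_pow_left₀ (by have := hpos j; positivity) (hψ j) 2
          have h2 : a j + lam = ((a j + lam) ^ p) ^ 2 * (a j + lam) ^ (-β) := by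
            rw [← Real.rpow_natCast, ← Real.rpow_mul (hpos j).le, ← Real.rpow_add (hpos j), hβ]
            norm_num
            rw [show p * 2 + (1 - 2 * p) = 1 by ring, Real.rpow_one]
          have h3 := hx _ (hpos j)
          have h4 : 0 ≤ T ^ β * (a j + lam) ^ (-β) := by have := hpos j; positivity
          calc _ = (|ψ (a j)| * (a j + lam) ^ p) ^ 2 * (T ^ β * (a j + lam) ^ (-β))
                * inner ℝ (e j) f ^ 2 := by
                nth_rewrite 1 [h2]
                rw [mul_pow, sq_abs]; ring
            _ ≤ c ^ 2 * (1 + T * (a j + lam)⁻¹) * inner ℝ (e j) f ^ 2 := by gcongr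
            _ = _ := by ring
      _ = c ^ 2 * (1 + T * t) := by
          rw [← Finset.mul_sum, Finset.sum_add_distrib, hf1, ← Finset.mul_sum]
      _ ≤ 2 * c ^ 2 := by nlinarith [sq_nonneg c]
  have hE0 : 0 ≤ inner ℝ (act (specFun ψ A) f) (act A (act (specFun ψ A) f))
        + lam * ‖act (specFun ψ A) f‖ ^ 2 := by
    rw [energy_specFun hA.1]
    exact Finset.sum_nonneg fun j _ => by have := (hpos j).le; positivity
  have hσT : σ ^ β ≤ (1 + B) * T ^ β := by
    calc σ ^ β ≤ ((1 + B) * T) ^ β := by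
          refine Real.rpow_le_rpow hσ0 ?_ hβ0
          rw [hT, mul_div_cancel₀ _ (by linarith)]; linarith
      _ = (1 + B) ^ β * T ^ β := Real.mul_rpow (by linarith) hT0.le
      _ ≤ (1 + B) * T ^ β := by
          gcongr
          calc (1 + B) ^ β ≤ (1 + B) ^ (1 : ℝ) :=
                Real.rpow_le_rpow_of_exponent_le (by linarith) hβ1
            _ = 1 + B := Real.rpow_one _
  have h1 := mul_le_mul_of_nonneg_right hσT hE0
  have h2 := mul_le_mul_of_nonneg_left hE (by linarith : (0 : ℝ) ≤ 1 + B)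
  linarith

/-- The residual `1 - t g(t)` of a filter of qualification at least `p`, measured at
`(t + lam) ^ p`. -/
theorem filter_residual_le {Cx b lam p : ℝ} {qual : EReal} {gam : ℝ → ℝ} {g : ℝ → ℝ → ℝ}
    (hg : IsFilter Cx b qual gam g) (hlam : 0 < lam) (hlamle : lam ≤ Cx ^ 2) (hp0 : 1 / 2 ≤ p)
    (hp1 : p ≤ 1) (hpq : (p : EReal) ≤ qual) {t : ℝ} (ht0 : 0 ≤ t) (ht : t ≤ Cx ^ 2) :
    |1 - g lam t * t| * (t + lam) ^ p ≤ (gam p + 1 + b) * lam ^ p := by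
  obtain ⟨hb, -, hgam, hgg⟩ := hg
  have hlp : 0 < lam ^ p := Real.rpow_pos_of_pos hlam p
  rcases ht0.eq_or_lt with rfl | ht0'
  · simp only [mul_zero, sub_zero, abs_one, zero_add, one_mul]
    have := hgam p
    nlinarith
  · obtain ⟨-, h2, h3⟩ := hgg lam hlam hlamle t ht0' ht
    have h3 := h3 p (by linarith) hpq
    have h4 : (t + lam) ^ p ≤ t ^ p + lam ^ p :=
      Real.rpow_add_le_add_rpow ht0 hlam.le (by linarith) hp1
    have h5 : |1 - g lam t * t| ≤ 1 + b := by
      calc |1 - g lam t * t| ≤ |(1 : ℝ)| + |g lam t * t| := abs_sub _ _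
        _ ≤ 1 + b := by rw [abs_one]; linarith
    calc |1 - g lam t * t| * (t + lam) ^ p
        ≤ |1 - g lam t * t| * (t ^ p + lam ^ p) := by gcongr
      _ = |1 - g lam t * t| * t ^ p + |1 - g lam t * t| * lam ^ p := mul_add _ _ _
      _ ≤ gam p * lam ^ p + (1 + b) * lam ^ p := by gcongr
      _ = _ := by ring

theorem norm_act_half_le {d : ℕ} {A S : Matrix (Fin d) (Fin d) ℝ} (hA : A.PosSemidef)
    (hS : S.PosSemidef) {lam B : ℝ} (hlam : 0 < lam)
    (hAS : ∀ v, inner ℝ v (act S v) + lam * ‖v‖ ^ 2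
      ≤ (1 + B) * (inner ℝ v (act A v) + lam * ‖v‖ ^ 2)) (v : Feat d) :
    ‖act (matPow S (1 / 2)) v‖
      ≤ Real.sqrt (1 + B) * ‖act (matPow (shift A lam) (1 / 2)) v‖ := by
  rw [← Real.sqrt_sq (norm_nonneg (act (matPow S (1 / 2)) v)),
    ← Real.sqrt_sq (norm_nonneg (act (matPow (shift A lam) (1 / 2)) v)),
    ← Real.sqrt_mul' _ (sq_nonneg _)]
  refine Real.sqrt_le_sqrt ?_
  rw [norm_act_matPow_half_sq hS, norm_act_shift_half_sq hA hlam]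
  have := hAS v
  nlinarith [sq_nonneg ‖v‖]

theorem act_sum {d : ℕ} {ι : Type*} (s : Finset ι) (A : Matrix (Fin d) (Fin d) ℝ)
    (v : ι → Feat d) : act A (∑ i ∈ s, v i) = ∑ i ∈ s, act A (v i) := by
  classical
  induction s using Finset.induction_on with
  | empty => ext i; simp [act]
  | insert i s hi ih => rw [Finset.sum_insert hi, Finset.sum_insert hi, act_add, ih]

/-- The error of the estimator at one parameter `lam`: noise of order `Q`, bias of order
`lam ^ p`, once `S + lam` is dominated by `Σ̂ + lam`. -/
theorem norm_half_estimator_sub_le {d n : ℕ} {D : Fin n → Obs d} {Cx b R p B Q lam : ℝ}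
    {qual : EReal} {gam : ℝ → ℝ} {g : ℝ → ℝ → ℝ} {S : Matrix (Fin d) (Fin d) ℝ}
    (hS : S.PosSemidef) (θ : Feat d) (hD : ∀ i, ‖(D i).1‖ ≤ Cx)
    (hg : IsFilter Cx b qual gam g) (hlam : 0 < lam) (hlamle : lam ≤ Cx ^ 2)
    (hp0 : 1 / 2 ≤ p) (hp1 : p ≤ 1) (hpq : (p : EReal) ≤ qual)
    (hB : 0 ≤ B) (hQ : 0 ≤ Q) (hR : 0 ≤ R)
    (hAS : ∀ v, inner ℝ v (act S v) + lam * ‖v‖ ^ 2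
      ≤ (1 + B) * (inner ℝ v (act (empCov D) v) + lam * ‖v‖ ^ 2))
    (hξ : ∀ u, inner ℝ (empCross D - act (empCov D) θ) u ^ 2
      ≤ Q ^ 2 * (inner ℝ u (act S u) + lam * ‖u‖ ^ 2))
    (hθ : ∀ l, |inner ℝ (hS.1.eigenvectorBasis l) θ|
      ≤ R * hS.1.eigenvalues l ^ (p - 1 / 2)) :
    ‖act (matPow S (1 / 2)) (estimator g D lam - θ)‖
      ≤ (1 + B) * (2 * b * Q + d * (R * (2 * ((gam p + 1 + b) * lam ^ p)))) := by
  have hA := posSemidef_empCov D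
  set A := empCov D with hAdef
  set a := hA.1.eigenvalues with ha
  set e := hA.1.eigenvectorBasis with he
  set ξ := empCross D - act A θ with hξdef
  set H := matPow (shift A lam) (1 / 2) with hH
  set ψ : ℝ → ℝ := fun t => 1 - g lam t * t with hψ
  have hb : 0 < b := hg.1
  have hgam : 0 < gam p := hg.2.2.1 p
  have ha0 : ∀ j, 0 ≤ a j := hA.eigenvalues_nonneg
  have haC : ∀ j, a j ≤ Cx ^ 2 := eigenvalues_empCov_le hD
  have h1B : (0 : ℝ) ≤ 1 + B := by linarith
  have hx0 : ∀ j, a j = 0 → ∀ i, inner ℝ (D i).1 (e j) = 0 := by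
    intro j hj i
    refine inner_eq_zero_of_empCov D (e j) ?_ i
    rw [act_eigenvectorBasis hA.1]
    change inner ℝ (e j) (a j • e j) = 0
    rw [hj]; simp
  have h0 : ∀ j, a j = 0 → inner ℝ (e j) ξ = 0 := by
    intro j hj
    have h1 : inner ℝ (e j) (act A θ) = 0 := by
      rw [inner_eigenvectorBasis_act hA.1]
      change a j * _ = 0
      rw [hj, zero_mul]
    rw [hξdef, inner_sub_right, h1, real_inner_comm, inner_empCross]
    simp [hx0 j hj]
  have hsplit : estimator g D lam - θ = act (specFun (g lam) A) ξ - act (specFun ψ A) θ := by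
    apply e.repr.injective
    ext j
    rw [e.repr_apply_apply, e.repr_apply_apply, estimator, ← hAdef, hξdef, act_sub,
      inner_sub_right, inner_sub_right, inner_sub_right,
      inner_eigenvectorBasis_specFun hA.1, inner_eigenvectorBasis_specFun hA.1,
      inner_eigenvectorBasis_specFun hA.1, inner_eigenvectorBasis_act hA.1]
    simp only [hψ]
    ring
  have hnoise : ‖act H (act (specFun (g lam) A) ξ)‖ ≤ 2 * b * Q * Real.sqrt (1 + B) := by
    refine abs_le_of_sq_le_sq' ?_ (by positivity) |>.2
    rw [hH, norm_act_shift_half_sq hA hlam, mul_pow, mul_pow, Real.sq_sqrt h1B]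
    refine energy_noise_le hA hlam hB hAS (g lam) ξ (fun j hj => ?_) h0 hξ
    obtain ⟨h1, h2, -⟩ := hg.2.2.2 lam hlam hlamle (a j) hj (haC j)
    change |g lam (a j)| * (a j + lam) ≤ 2 * b
    rw [abs_mul, abs_of_pos (show 0 < a j from hj)] at h2
    rw [le_div_iff₀ hlam] at h1
    nlinarith
  have hbias1 : ∀ l, |inner ℝ (hS.1.eigenvectorBasis l) θ|
      * ‖act H (act (specFun ψ A) (hS.1.eigenvectorBasis l))‖
      ≤ R * (2 * ((gam p + 1 + b) * lam ^ p)) * Real.sqrt (1 + B) := by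
    intro l
    have hc : 0 ≤ (gam p + 1 + b) * lam ^ p := by positivity
    have h1 := energy_bias_le hA hS hlam hB hAS hp0 hp1 ψ
      (fun j => filter_residual_le hg hlam hlamle hp0 hp1 hpq (ha0 j) (haC j)) l
    rw [← norm_act_shift_half_sq hA hlam, ← hH,
      show (2 * p - 1 : ℝ) = (p - 1 / 2) * (2 : ℕ) by push_cast; ring,
      Real.rpow_mul (hS.eigenvalues_nonneg l), Real.rpow_natCast, ← mul_pow] at h1
    have h2 : hS.1.eigenvalues l ^ (p - 1 / 2)
        * ‖act H (act (specFun ψ A) (hS.1.eigenvectorBasis l))‖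
        ≤ 2 * ((gam p + 1 + b) * lam ^ p) * Real.sqrt (1 + B) := by
      refine abs_le_of_sq_le_sq' ?_ (by positivity) |>.2
      refine h1.trans ?_
      rw [mul_pow (2 * ((gam p + 1 + b) * lam ^ p)), Real.sq_sqrt h1B, mul_pow 2]
      gcongr
      norm_num
    calc _ ≤ R * hS.1.eigenvalues l ^ (p - 1 / 2)
          * ‖act H (act (specFun ψ A) (hS.1.eigenvectorBasis l))‖ := by
            gcongr
            exact hθ l
      _ = R * (hS.1.eigenvalues l ^ (p - 1 / 2)
          * ‖act H (act (specFun ψ A) (hS.1.eigenvectorBasis l))‖) := mul_assoc _ _ _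
      _ ≤ R * (2 * ((gam p + 1 + b) * lam ^ p) * Real.sqrt (1 + B)) := by gcongr
      _ = _ := by ring
  have hbias : ‖act H (act (specFun ψ A) θ)‖
      ≤ d * (R * (2 * ((gam p + 1 + b) * lam ^ p))) * Real.sqrt (1 + B) := by
    have h1 : act H (act (specFun ψ A) θ) = ∑ l, inner ℝ (hS.1.eigenvectorBasis l) θ
        • act H (act (specFun ψ A) (hS.1.eigenvectorBasis l)) := by
      nth_rewrite 1 [← hS.1.eigenvectorBasis.sum_repr' θ]
      rw [act_sum, act_sum]
      simp_rw [act_smul]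
    rw [h1]
    calc _ ≤ ∑ l, ‖inner ℝ (hS.1.eigenvectorBasis l) θ
          • act H (act (specFun ψ A) (hS.1.eigenvectorBasis l))‖ := norm_sum_le _ _
      _ ≤ ∑ _l : Fin d, R * (2 * ((gam p + 1 + b) * lam ^ p)) * Real.sqrt (1 + B) := by
          refine Finset.sum_le_sum fun l _ => ?_
          rw [norm_smul, Real.norm_eq_abs]
          exact hbias1 l
      _ = _ := by simp; ring
  calc _ ≤ Real.sqrt (1 + B) * ‖act H (estimator g D lam - θ)‖ :=
        norm_act_half_le hA hS hlam hAS _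
    _ ≤ Real.sqrt (1 + B) * (2 * b * Q * Real.sqrt (1 + B)
        + d * (R * (2 * ((gam p + 1 + b) * lam ^ p))) * Real.sqrt (1 + B)) := by
        gcongr
        rw [hsplit, act_sub]
        exact (norm_sub_le _ _).trans (add_le_add hnoise hbias)
    _ = Real.sqrt (1 + B) * Real.sqrt (1 + B)
        * (2 * b * Q + d * (R * (2 * ((gam p + 1 + b) * lam ^ p)))) := by ring
    _ = _ := by rw [Real.mul_self_sqrt h1B]

/-! ### A Bernstein inequality for `τ`-mixing observations -/

/-- The Euclidean distance of two observations. The metric instance of the product `Obs d` is the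
sup metric, whereas the mixing coefficient is defined with this one. -/
noncomputable def obsDist {d : ℕ} (w w' : Obs d) : ℝ :=
  Real.sqrt (‖w.1 - w'.1‖ ^ 2 + (w.2 - w'.2) ^ 2)

theorem norm_fst_sub_le_obsDist {d : ℕ} (w w' : Obs d) : ‖w.1 - w'.1‖ ≤ obsDist w w' :=
  Real.le_sqrt_of_sq_le (by nlinarith [sq_nonneg (w.2 - w'.2)])

theorem abs_snd_sub_le_obsDist {d : ℕ} (w w' : Obs d) : |w.2 - w'.2| ≤ obsDist w w' := by
  refine Real.le_sqrt_of_sq_le ?_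
  rw [sq_abs]
  nlinarith [sq_nonneg ‖w.1 - w'.1‖]

theorem measurable_of_obsDist {d : ℕ} {f : Obs d → ℝ} {Λ : ℝ}
    (hf : ∀ w w', |f w - f w'| ≤ Λ * obsDist w w') : Measurable f := by
  refine Continuous.measurable (continuous_iff_continuousAt.2 fun w => ?_)
  rw [ContinuousAt, tendsto_iff_dist_tendsto_zero]
  have hc : Continuous fun w' : Obs d => Λ * obsDist w' w := by
    unfold obsDist; fun_prop
  have h0 : Filter.Tendsto (fun w' : Obs d => Λ * obsDist w' w) (nhds w) (nhds 0) := by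
    have := hc.tendsto w
    simpa [obsDist] using this
  exact squeeze_zero (fun _ => dist_nonneg) (fun w' => by rw [Real.dist_eq]; exact hf w' w) h0

theorem past_le {Ω : Type*} [m0 : MeasurableSpace Ω] {d : ℕ} {z : ℕ → Ω → Obs d}
    (hz : ∀ i, Measurable (z i)) (i : ℕ) : past z i ≤ m0 :=
  iSup₂_le fun l _ => (hz l).comap_le

theorem measurable_past {Ω : Type*} {d : ℕ} (z : ℕ → Ω → Obs d) {l i : ℕ} (hl : l ≤ i) :
    Measurable[past z i] (z l) :=
  measurable_iff_comap_le.2 (le_iSup₂ (f := fun l _ => MeasurableSpace.comap (z l) inferInstance)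
    l (Set.mem_Iic.2 hl))

theorem condExp_le_of_tauCoeff_le {Ω : Type*} [MeasurableSpace Ω] {d : ℕ} {μ : Measure Ω}
    {z : ℕ → Ω → Obs d} {j : ℕ} {τ Λ B : ℝ} (hΛ : 0 < Λ) (hτ0 : 0 ≤ τ)
    (hτ : tauCoeff μ z j ≤ ENNReal.ofReal τ) {h : Obs d → ℝ} (hB : ∀ w, |h w| ≤ B)
    (hh : ∀ w w', |h w - h w'| ≤ Λ * obsDist w w') (i : ℕ) :
    ∀ᵐ ω ∂μ, (μ[fun ω' => h (z (i + j) ω') | past z i]) ω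
      ≤ (∫ ω', h (z (i + j) ω') ∂μ) + Λ * τ := by
  have hmem : (fun w => Λ⁻¹ * h w) ∈ lipBall d := by
    refine ⟨⟨Λ⁻¹ * B, fun w => ?_⟩, fun w w' => ?_⟩
    · rw [abs_mul, abs_of_pos (inv_pos.2 hΛ)]
      exact mul_le_mul_of_nonneg_left (hB w) (inv_pos.2 hΛ).le
    · rw [← mul_sub, abs_mul, abs_of_pos (inv_pos.2 hΛ), inv_mul_le_iff₀ hΛ]
      exact hh w w'
  have h1 : eLpNorm (fun ω => (μ[fun ω' => Λ⁻¹ * h (z (i + j) ω') | past z i]) ω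
      - ∫ ω', Λ⁻¹ * h (z (i + j) ω') ∂μ) ⊤ μ ≤ ENNReal.ofReal τ := by
    refine le_trans ?_ hτ
    unfold tauCoeff
    exact le_iSup₂_of_le i (fun w => Λ⁻¹ * h w) (le_iSup_of_le hmem le_rfl)
  rw [eLpNorm_exponent_top] at h1
  have hsm := condExp_smul (μ := μ) Λ⁻¹ (fun ω' => h (z (i + j) ω')) (past z i)
  filter_upwards [enorm_ae_le_eLpNormEssSup (fun ω =>
    (μ[fun ω' => Λ⁻¹ * h (z (i + j) ω') | past z i]) ω
      - ∫ ω', Λ⁻¹ * h (z (i + j) ω') ∂μ) μ, hsm] with ω hω hs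
  have h2 := hω.trans h1
  rw [← ofReal_norm, ENNReal.ofReal_le_ofReal_iff hτ0, Real.norm_eq_abs] at h2
  have h3 := (abs_le.1 h2).2
  change (μ[fun ω' => Λ⁻¹ * h (z (i + j) ω') | past z i]) ω = Λ⁻¹ * _ at hs
  rw [hs, integral_const_mul, ← mul_sub, inv_mul_le_iff₀ hΛ] at h3
  linarith

/-- One conditioning step: replacing `h (z_{i+j})` by its mean under a past-measurable weight costs
`Λ τ`. -/
theorem integral_mul_le_of_tauCoeff_le {Ω : Type*} [MeasurableSpace Ω] {d : ℕ} {μ : Measure Ω}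
    [IsProbabilityMeasure μ] {z : ℕ → Ω → Obs d} (hz : ∀ i, Measurable (z i)) {j : ℕ}
    {τ Λ B B' : ℝ} (hΛ : 0 < Λ) (hτ0 : 0 ≤ τ) (hτ : tauCoeff μ z j ≤ ENNReal.ofReal τ)
    {h : Obs d → ℝ} (hB : ∀ w, |h w| ≤ B)
    (hh : ∀ w w', |h w - h w'| ≤ Λ * obsDist w w') (i : ℕ) {G : Ω → ℝ}
    (hG : Measurable[past z i] G) (hG0 : ∀ ω, 0 ≤ G ω) (hGB : ∀ ω, G ω ≤ B') :
    ∫ ω, G ω * h (z (i + j) ω) ∂μ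
      ≤ ((∫ ω, h (z (i + j) ω) ∂μ) + Λ * τ) * ∫ ω, G ω ∂μ := by
  have hhm : Measurable h := measurable_of_obsDist hh
  have hG' : Measurable G := hG.mono (past_le hz i) le_rfl
  have hGint : Integrable G μ :=
    Integrable.of_bound hG'.aestronglyMeasurable B'
      (Filter.Eventually.of_forall fun ω => by
        rw [Real.norm_eq_abs, abs_of_nonneg (hG0 ω)]; exact hGB ω)
  have hhint : Integrable (fun ω => h (z (i + j) ω)) μ :=
    Integrable.of_bound (hhm.comp (hz _)).aestronglyMeasurable B
      (Filter.Eventually.of_forall fun ω => hB _)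
  have hGh : Integrable (G * fun ω => h (z (i + j) ω)) μ :=
    hhint.bdd_mul hG'.aestronglyMeasurable (c := B') (Filter.Eventually.of_forall fun ω => by
        rw [Real.norm_eq_abs, abs_of_nonneg (hG0 ω)]; exact hGB ω)
  have hpull := condExp_mul_of_stronglyMeasurable_left (μ := μ) (m := past z i)
    hG.stronglyMeasurable hGh hhint
  calc ∫ ω, G ω * h (z (i + j) ω) ∂μ
      = ∫ ω, (μ[G * fun ω => h (z (i + j) ω) | past z i]) ω ∂μ :=
        (integral_condExp (past_le hz i)).symm
    _ = ∫ ω, G ω * (μ[fun ω => h (z (i + j) ω) | past z i]) ω ∂μ := integral_congr_ae hpull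
    _ ≤ ∫ ω, G ω * ((∫ ω, h (z (i + j) ω) ∂μ) + Λ * τ) ∂μ := by
        refine integral_mono_ae (integrable_condExp.congr hpull) (hGint.mul_const _) ?_
        filter_upwards [condExp_le_of_tauCoeff_le hΛ hτ0 hτ hB hh i] with ω hω
        exact mul_le_mul_of_nonneg_left hω (hG0 ω)
    _ = _ := by rw [integral_mul_const, mul_comm]

theorem abs_exp_sub_exp_le {u v : ℝ} (hu : |u| ≤ 1) (hv : |v| ≤ 1) :
    |Real.exp u - Real.exp v| ≤ 3 * |u - v| := by
  have key : ∀ x y : ℝ, |y| ≤ 1 → Real.exp y - Real.exp x ≤ 3 * |x - y| := by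
    intro x y hy
    have h1 : Real.exp x = Real.exp y * Real.exp (x - y) := by rw [← Real.exp_add]; ring_nf
    have h2 := Real.add_one_le_exp (x - y)
    have h3 : Real.exp y ≤ 3 :=
      (Real.exp_le_exp.2 (abs_le.1 hy).2).trans (Real.exp_one_lt_d9.le.trans (by norm_num))
    have h4 := Real.exp_pos y
    calc Real.exp y - Real.exp x ≤ Real.exp y * (y - x) := by rw [h1]; nlinarith
      _ ≤ Real.exp y * |x - y| := by gcongr; rw [abs_sub_comm]; exact le_abs_self _
      _ ≤ 3 * |x - y| := by gcongr
  rw [abs_le]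
  constructor
  · have := key u v hv
    linarith
  · have := key v u hu
    rw [abs_sub_comm] at this
    linarith

/-- The exponential moment along one residue class modulo `k`. -/
theorem integral_exp_class_le {Ω : Type*} [MeasurableSpace Ω] {d : ℕ} {μ : Measure Ω}
    [IsProbabilityMeasure μ] {P : Measure (Obs d)} {z : ℕ → Ω → Obs d}
    (hz : ∀ i, Measurable (z i)) (hP : ∀ i, μ.map (z i) = P) {k : ℕ}
    {τ Λ B c : ℝ} (hΛ : 0 < Λ) (hτ0 : 0 ≤ τ) (hτ : tauCoeff μ z k ≤ ENNReal.ofReal τ)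
    {f : Obs d → ℝ} (hf : Measurable f) (hB : ∀ w, |f w| ≤ B)
    (hh : ∀ w w', |Real.exp (f w) - Real.exp (f w')| ≤ Λ * obsDist w w')
    (hc : 0 ≤ c) (hmgf : (∫ w, Real.exp (f w) ∂P) + Λ * τ ≤ Real.exp c) (n r m : ℕ) :
    ∫ ω, Real.exp (∑ l ∈ Finset.range m,
        if r + l * k < n then f (z (r + l * k) ω) else 0) ∂μ ≤ Real.exp (c * m) := by
  have hmap : ∀ i, ∫ ω, Real.exp (f (z i ω)) ∂μ = ∫ w, Real.exp (f w) ∂P := by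
    intro i
    rw [← hP i]
    exact (integral_map (f := fun w => Real.exp (f w)) (hz i).aemeasurable
      (Real.measurable_exp.comp hf).aestronglyMeasurable).symm
  have hexpB : ∀ w, |Real.exp (f w)| ≤ Real.exp B := fun w => by
    rw [Real.abs_exp]; exact Real.exp_le_exp.2 (abs_le.1 (hB w)).2
  have hτΛ : 0 ≤ Λ * τ := by positivity
  induction m with
  | zero => simp
  | succ m ih =>
    have hstep : Real.exp (c * m) ≤ Real.exp (c * (m + 1 : ℕ)) :=
      Real.exp_le_exp.2 (by push_cast; nlinarith)
    simp_rw [Finset.sum_range_succ]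
    by_cases hlt : r + m * k < n
    · simp only [hlt, if_true, Real.exp_add]
      rcases m with _ | m
      · simp only [Finset.range_zero, Finset.sum_empty, Real.exp_zero, one_mul, hmap]
        simp only [zero_add, Nat.cast_one, mul_one]
        linarith
      · have hidx : r + (m + 1) * k = r + m * k + k := by ring
        rw [hidx]
        set G : Ω → ℝ := fun ω => Real.exp (∑ l ∈ Finset.range (m + 1),
          if r + l * k < n then f (z (r + l * k) ω) else 0) with hG
        have hGm : Measurable[past z (r + m * k)] G := by
          refine Real.measurable_exp.comp (Finset.measurable_sum _ fun l hl => ?_)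
          have hl' : l ≤ m := Nat.lt_succ_iff.1 (Finset.mem_range.1 hl)
          split_ifs
          · exact hf.comp (measurable_past z (by gcongr))
          · exact measurable_const
        have hGB : ∀ ω, G ω ≤ Real.exp ((m + 1 : ℕ) * |B|) := by
          intro ω
          refine Real.exp_le_exp.2 ((Finset.sum_le_card_nsmul _ _ |B| fun l _ => ?_).trans_eq ?_)
          · split_ifs
            · exact (le_abs_self _).trans ((hB _).trans (le_abs_self _))
            · exact abs_nonneg _
          · simp
        have h1 := integral_mul_le_of_tauCoeff_le hz hΛ hτ0 hτ hexpB hh (r + m * k) hGm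
          (fun ω => (Real.exp_pos _).le) hGB
        rw [hmap] at h1
        refine h1.trans ?_
        calc _ ≤ Real.exp c * Real.exp (c * (m + 1 : ℕ)) := by
              refine mul_le_mul hmgf ih (integral_nonneg fun ω => (Real.exp_pos _).le)
                (Real.exp_pos _).le
          _ = _ := by rw [← Real.exp_add]; push_cast; ring_nf
    · simp only [hlt, if_false, add_zero]
      exact ih.trans hstep

theorem sum_range_mul_eq {k : ℕ} (F : ℕ → ℝ) (m : ℕ) :
    ∑ i ∈ Finset.range (m * k), F i
      = ∑ r ∈ Finset.range k, ∑ l ∈ Finset.range m, F (r + l * k) := by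
  rw [Finset.sum_comm]
  induction m with
  | zero => simp
  | succ m ih =>
    rw [Finset.sum_range_succ, ← ih, Nat.succ_mul, Finset.sum_range_add]
    congr 1
    exact Finset.sum_congr rfl fun r _ => by rw [add_comm]

/-- The `k` interleaved classes are combined by convexity of the exponential. -/
theorem integral_exp_sum_le {Ω : Type*} [MeasurableSpace Ω] {d : ℕ} {μ : Measure Ω}
    [IsProbabilityMeasure μ] {P : Measure (Obs d)} {z : ℕ → Ω → Obs d}
    (hz : ∀ i, Measurable (z i)) (hP : ∀ i, μ.map (z i) = P) {k : ℕ} (hk : 1 ≤ k)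
    {τ Λ B c : ℝ} (hΛ : 0 < Λ) (hτ0 : 0 ≤ τ) (hτ : tauCoeff μ z k ≤ ENNReal.ofReal τ)
    {f : Obs d → ℝ} (hf : Measurable f) (hB : ∀ w, |f w| ≤ B)
    (hh : ∀ w w', |Real.exp (f w) - Real.exp (f w')| ≤ Λ * obsDist w w')
    (hc : 0 ≤ c) (hmgf : (∫ w, Real.exp (f w) ∂P) + Λ * τ ≤ Real.exp c) {n m : ℕ}
    (hnm : n ≤ m * k) :
    ∫ ω, Real.exp ((1 / (k : ℝ)) * ∑ i ∈ Finset.range n, f (z i ω)) ∂μ ≤ Real.exp (c * m) := by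
  have hk' : (0 : ℝ) < k := by exact_mod_cast hk
  set S : ℕ → Ω → ℝ := fun r ω => ∑ l ∈ Finset.range m,
        if r + l * k < n then f (z (r + l * k) ω) else 0 with hS
  have hsum : ∀ ω, ∑ i ∈ Finset.range n, f (z i ω) = ∑ r ∈ Finset.range k, S r ω := by
    intro ω
    rw [← sum_range_mul_eq (fun i => if i < n then f (z i ω) else 0) m, ← Finset.sum_filter]
    congr 1
    ext i
    simp only [Finset.mem_filter, Finset.mem_range]
    omega
  have hSm : ∀ r, Measurable (S r) := by
    intro r
    refine Finset.measurable_sum _ fun l _ => ?_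
    split_ifs
    · exact hf.comp (hz _)
    · exact measurable_const
  have hSB : ∀ r ω, S r ω ≤ m * |B| := by
    intro r ω
    refine (Finset.sum_le_card_nsmul _ _ |B| fun l _ => ?_).trans_eq (by simp)
    split_ifs
    · exact (le_abs_self _).trans ((hB _).trans (le_abs_self _))
    · exact abs_nonneg _
  have hSint : ∀ r, Integrable (fun ω => Real.exp (S r ω)) μ := fun r =>
    Integrable.of_bound (Real.measurable_exp.comp (hSm r)).aestronglyMeasurable
      (Real.exp (m * |B|)) (Filter.Eventually.of_forall fun ω => by
        rw [Real.norm_eq_abs, Real.abs_exp]; exact Real.exp_le_exp.2 (hSB r ω))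
  have hjensen : ∀ ω, Real.exp ((1 / (k : ℝ)) * ∑ i ∈ Finset.range n, f (z i ω))
      ≤ (1 / (k : ℝ)) * ∑ r ∈ Finset.range k, Real.exp (S r ω) := by
    intro ω
    have h := convexOn_exp.map_sum_le (t := Finset.range k) (w := fun _ => 1 / (k : ℝ))
      (p := fun r => S r ω) (fun _ _ => by positivity) (by simp; field_simp)
      (fun _ _ => Set.mem_univ _)
    simp only [smul_eq_mul, ← Finset.mul_sum] at h
    rw [hsum]
    exact h
  have hint : Integrable (fun ω => (1 / (k : ℝ)) * ∑ r ∈ Finset.range k, Real.exp (S r ω)) μ :=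
    (integrable_finsetSum _ fun r _ => hSint r).const_mul _
  calc _ ≤ ∫ ω, (1 / (k : ℝ)) * ∑ r ∈ Finset.range k, Real.exp (S r ω) ∂μ :=
        integral_mono_of_nonneg (Filter.Eventually.of_forall fun ω => (Real.exp_pos _).le) hint
          (Filter.Eventually.of_forall hjensen)
    _ = (1 / (k : ℝ)) * ∑ r ∈ Finset.range k, ∫ ω, Real.exp (S r ω) ∂μ := by
        rw [integral_const_mul, integral_finsetSum _ fun r _ => hSint r]
    _ ≤ (1 / (k : ℝ)) * ∑ _r ∈ Finset.range k, Real.exp (c * m) := by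
        gcongr with r
        exact integral_exp_class_le hz hP hΛ hτ0 hτ hf hB hh hc hmgf n r m
    _ = Real.exp (c * m) := by simp; field_simp

/-- A Chernoff bound of Bernstein type, with `k` the gap between the observations that are treated
as almost independent and `a` the free parameter of the exponential moment. -/
theorem measure_mean_ge_le {Ω : Type*} [MeasurableSpace Ω] {d : ℕ} {μ : Measure Ω}
    [IsProbabilityMeasure μ] {P : Measure (Obs d)} [IsProbabilityMeasure P] {z : ℕ → Ω → Obs d}
    (hz : ∀ i, Measurable (z i)) (hP : ∀ i, μ.map (z i) = P) {k : ℕ} (hk : 1 ≤ k)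
    {τ Λ B V a : ℝ} (hΛ : 0 < Λ) (ha : 0 < a) (hτ0 : 0 ≤ τ)
    (hτ : tauCoeff μ z k ≤ ENNReal.ofReal τ)
    {f : Obs d → ℝ} (hB : ∀ w, |f w| ≤ B)
    (hf : ∀ w w', |f w - f w'| ≤ Λ * obsDist w w') (hmean : ∫ w, f w ∂P = 0)
    (hvar : ∫ w, f w ^ 2 ∂P ≤ V) (haB : a * B ≤ 1) {n m : ℕ}
    (hnm : n ≤ m * k) (hn : 1 ≤ n) (t : ℝ) :
    μ {ω | t ≤ (1 / (n : ℝ)) * ∑ i ∈ Finset.range n, f (z i ω)}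
      ≤ ENNReal.ofReal (Real.exp (-(a * (n / k) * t) + m * (a ^ 2 * V + 3 * a * Λ * τ))) := by
  have hk' : (0 : ℝ) < k := by exact_mod_cast hk
  have hn' : (0 : ℝ) < n := by exact_mod_cast hn
  have hfm : Measurable f := measurable_of_obsDist hf
  have haf : ∀ w, |a * f w| ≤ 1 := fun w => by
    rw [abs_mul, abs_of_pos ha]
    exact (mul_le_mul_of_nonneg_left (hB w) ha.le).trans haB
  have hV : 0 ≤ V := (integral_nonneg fun w => sq_nonneg (f w)).trans hvar
  have hfi : Integrable f P := Integrable.of_bound hfm.aestronglyMeasurable B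
    (Filter.Eventually.of_forall hB)
  have hf2i : Integrable (fun w => f w ^ 2) P :=
    Integrable.of_bound (hfm.pow_const 2).aestronglyMeasurable (B ^ 2)
      (Filter.Eventually.of_forall fun w => by
        rw [Real.norm_eq_abs, abs_pow]
        exact pow_le_pow_left₀ (abs_nonneg _) (hB w) 2)
  have hmgf : (∫ w, Real.exp (a * f w) ∂P) + (3 * a * Λ) * τ
      ≤ Real.exp (a ^ 2 * V + 3 * a * Λ * τ) := by
    have h1 : ∫ w, Real.exp (a * f w) ∂P ≤ ∫ w, (1 + a * f w + a ^ 2 * f w ^ 2) ∂P := by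
      refine integral_mono_of_nonneg (Filter.Eventually.of_forall fun w => (Real.exp_pos _).le)
        (((integrable_const 1).add (hfi.const_mul a)).add (hf2i.const_mul _))
        (Filter.Eventually.of_forall fun w => ?_)
      have := (abs_le.1 (Real.abs_exp_sub_one_sub_id_le (haf w))).2
      change Real.exp (a * f w) ≤ 1 + a * f w + a ^ 2 * f w ^ 2
      nlinarith
    have h2 : ∫ w, (1 + a * f w + a ^ 2 * f w ^ 2) ∂P = 1 + a ^ 2 * ∫ w, f w ^ 2 ∂P := by
      have hi : Integrable (fun w => 1 + a * f w) P := (integrable_const 1).add (hfi.const_mul a)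
      rw [integral_add hi (hf2i.const_mul _), integral_add (integrable_const 1) (hfi.const_mul a),
        integral_const_mul, integral_const_mul, hmean]
      simp
    have h3 := Real.add_one_le_exp (a ^ 2 * V + 3 * a * Λ * τ)
    have h4 : a ^ 2 * ∫ w, f w ^ 2 ∂P ≤ a ^ 2 * V := by gcongr
    linarith
  have hlip : ∀ w w', |Real.exp (a * f w) - Real.exp (a * f w')| ≤ 3 * a * Λ * obsDist w w' := by
    intro w w'
    refine (abs_exp_sub_exp_le (haf w) (haf w')).trans ?_
    rw [← mul_sub, abs_mul, abs_of_pos ha]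
    have := mul_le_mul_of_nonneg_left (hf w w') ha.le
    nlinarith
  have hmain := integral_exp_sum_le hz hP hk (by positivity : 0 < 3 * a * Λ) hτ0 hτ
    (hfm.const_mul a) haf hlip (by positivity) hmgf hnm
  set X : Ω → ℝ := fun ω => (1 / (n : ℝ)) * ∑ i ∈ Finset.range n, f (z i ω) with hX
  have hXm : Measurable X :=
    (Finset.measurable_sum _ fun i _ => hfm.comp (hz i)).const_mul _
  have hXB : ∀ ω, |X ω| ≤ B := by
    intro ω
    rw [hX]
    simp only
    rw [abs_mul, abs_of_pos (by positivity : (0 : ℝ) < 1 / n), one_div, inv_mul_le_iff₀ hn']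
    refine (Finset.abs_sum_le_sum_abs _ _).trans
      ((Finset.sum_le_card_nsmul _ _ B fun i _ => hB _).trans_eq (by simp))
  have ha' : 0 ≤ a * (n / k) := by positivity
  have hint : Integrable (fun ω => Real.exp (a * (n / k) * X ω)) μ :=
    Integrable.of_bound (Real.measurable_exp.comp (hXm.const_mul _)).aestronglyMeasurable
      (Real.exp (a * (n / k) * B)) (Filter.Eventually.of_forall fun ω => by
        rw [Real.norm_eq_abs, Real.abs_exp]
        exact Real.exp_le_exp.2 (mul_le_mul_of_nonneg_left (abs_le.1 (hXB ω)).2 ha'))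
  have hch := ProbabilityTheory.measure_ge_le_exp_mul_mgf (μ := μ) (X := X) t ha' hint
  have hmg : ProbabilityTheory.mgf X μ (a * (n / k))
      ≤ Real.exp ((a ^ 2 * V + 3 * a * Λ * τ) * m) := by
    refine le_trans (le_of_eq ?_) hmain
    rw [ProbabilityTheory.mgf]
    congr 1
    ext ω
    rw [hX, ← Finset.mul_sum]
    field_simp
  rw [← ENNReal.ofReal_toReal (measure_ne_top μ _)]
  refine ENNReal.ofReal_le_ofReal (hch.trans ?_)
  calc _ ≤ Real.exp (-(a * (n / k)) * t) * Real.exp ((a ^ 2 * V + 3 * a * Λ * τ) * m) := by gcongr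
    _ = _ := by rw [← Real.exp_add]; ring_nf

/-! ### Deviations at the effective sample size -/

/-- A gap `k` for which the mixing coefficient is of order `1 / n` while `n / k` is comparable to
the effective sample size. -/
theorem exists_gap {b0 c0 γ0 Cx M t : ℝ} (hb0 : 0 < b0) (hc0 : 0 ≤ c0) (hγ0 : 0 < γ0)
    (hCx : 0 < Cx) (n : ℕ) :
    ∃ k : ℕ, 1 ≤ k ∧ 2 * effSize b0 c0 γ0 Cx M t n / (1 + b0) ≤ n / k
      ∧ (n : ℝ) / k ≤ 2 * effSize b0 c0 γ0 Cx M t n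
      ∧ n * (c0 * Real.exp (-(b0 * k) ^ γ0)) ≤ Cx / b0 := by
  rw [effSize]
  set mx := max (Real.sqrt 2 * max (M + 2 * Cx * t) Cx / (2 * Cx * M)) (1 / Cx) with hmx
  have hmx1 : 1 / Cx ≤ mx := le_max_right _ _
  have hmx0 : 0 < mx := lt_of_lt_of_le (by positivity) hmx1
  set G := max 1 (Real.log (c0 * b0 * mx * n)) with hG
  have hG1 : 1 ≤ G := le_max_left _ _
  set g := G ^ (1 / γ0) with hg
  have hg1 : 1 ≤ g := Real.one_le_rpow hG1 (by positivity)
  have hk0 : 0 < g / b0 := by positivity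
  have hkc : 0 < ⌈g / b0⌉₊ := Nat.ceil_pos.2 hk0
  have hk1 : g / b0 ≤ ⌈g / b0⌉₊ := Nat.le_ceil _
  have hk2 : (⌈g / b0⌉₊ : ℝ) < g / b0 + 1 := Nat.ceil_lt_add_one hk0.le
  set k := ⌈g / b0⌉₊ with hk
  have hkpos : (0 : ℝ) < k := by exact_mod_cast hkc
  have hn0 : (0 : ℝ) ≤ n := Nat.cast_nonneg n
  refine ⟨k, hkc, ?_, ?_, ?_⟩
  · have h1 : (k : ℝ) ≤ g * (1 + b0) / b0 := by
      refine hk2.le.trans ?_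
      rw [le_div_iff₀ hb0, add_mul, div_mul_cancel₀ _ hb0.ne']
      nlinarith
    calc 2 * (n * b0 / (2 * g)) / (1 + b0) = n / (g * (1 + b0) / b0) := by
          field_simp
      _ ≤ n / k := by gcongr
  · calc (n : ℝ) / k ≤ n / (g / b0) := by gcongr
      _ = 2 * (n * b0 / (2 * g)) := by field_simp
  · have hGk : G ≤ (b0 * k) ^ γ0 := by
      have h1 : g ≤ b0 * k := by
        rw [div_le_iff₀ hb0] at hk1; linarith
      calc G = g ^ γ0 := by
            rw [hg, ← Real.rpow_mul (by linarith), one_div, inv_mul_cancel₀ hγ0.ne', Real.rpow_one]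
        _ ≤ (b0 * k) ^ γ0 := Real.rpow_le_rpow (by linarith) h1 hγ0.le
    rcases (mul_nonneg hn0 hc0).eq_or_lt with h0 | h0
    · rw [← mul_assoc, ← h0, zero_mul]; positivity
    · have hc : 0 < c0 * b0 * mx * n := by
        have : c0 * b0 * mx * n = (n * c0) * (b0 * mx) := by ring
        rw [this]; positivity
      have h2 : Real.exp (-(b0 * k) ^ γ0) ≤ (c0 * b0 * mx * n)⁻¹ := by
        rw [← Real.exp_log (inv_pos.2 hc), Real.log_inv]
        exact Real.exp_le_exp.2 (neg_le_neg ((le_max_right _ _).trans hGk))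
      calc n * (c0 * Real.exp (-(b0 * k) ^ γ0)) = n * c0 * Real.exp (-(b0 * k) ^ γ0) := by ring
        _ ≤ n * c0 * (c0 * b0 * mx * n)⁻¹ := by gcongr
        _ = 1 / (b0 * mx) := by
            have hc' : c0 ≠ 0 := by rintro rfl; simp at h0
            have hn' : (n : ℝ) ≠ 0 := by intro h; rw [h] at h0; simp at h0
            field_simp
        _ ≤ 1 / (b0 * (1 / Cx)) := by gcongr
        _ = Cx / b0 := by field_simp

theorem one_le_log_two_div {δ : ℝ} (hδ : 0 < δ) (hδ2 : δ < 1 / 2) : 1 ≤ Real.log (2 / δ) := by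
  rw [Real.le_log_iff_exp_le (by positivity)]
  have h1 : (4 : ℝ) ≤ 2 / δ := by rw [le_div_iff₀ hδ]; linarith
  exact Real.exp_one_lt_d9.le.trans (by linarith)

/-- The Bernstein inequality at the effective sample size `N`, for a function of standard deviation
at most `√V0 s`: with the exponential parameter `a = 1 / (c4 √N s)` the exponent is
`- Q L / const + const`, and `Q` is taken so large that this is at most `- L - log cnt`, where
`L = log (2 / δ)` and `cnt` counts the events of the union bound. -/
theorem measure_mean_ge_le_effSize {Ω : Type*} [MeasurableSpace Ω] {d : ℕ} {μ : Measure Ω}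
    [IsProbabilityMeasure μ] {P : Measure (Obs d)} [IsProbabilityMeasure P] {z : ℕ → Ω → Obs d}
    (hz : ∀ i, Measurable (z i)) (hP : ∀ i, μ.map (z i) = P)
    {b0 c0 γ0 Cx M t : ℝ} (hb0 : 0 < b0) (hc0 : 0 ≤ c0) (hγ0 : 0 < γ0) (hCx : 0 < Cx)
    (hmix : IsGeomTauMixing μ z b0 c0 γ0)
    {n : ℕ} {N : ℝ} (hNdef : N = effSize b0 c0 γ0 Cx M t n) (hN : 1 ≤ N)
    {Λ B V0 s c4 Q cnt δ : ℝ} (hΛ : 0 < Λ) (hδ : 0 < δ) (hδ2 : δ < 1 / 2)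
    (hs : 0 < s) (hc4 : 0 < c4) (hcnt : 1 ≤ cnt)
    {f : Obs d → ℝ} (hB : ∀ w, |f w| ≤ B)
    (hf : ∀ w w', |f w - f w'| ≤ Λ * obsDist w w') (hmean : ∫ w, f w ∂P = 0)
    (hvar : ∫ w, f w ^ 2 ∂P ≤ V0 * s ^ 2)
    (hBs : B ≤ c4 * (Real.sqrt N * s)) (hΛs : Λ ≤ c4 * (Real.sqrt N * s))
    (hQ : 1 + (3 + b0) * V0 / c4 ^ 2 + 6 * Cx / b0 + Real.log cnt ≤ 2 * Q / ((1 + b0) * c4)) :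
    μ {ω | Q * Real.log (2 / δ) * s / Real.sqrt N
        ≤ (1 / (n : ℝ)) * ∑ i ∈ Finset.range n, f (z i ω)}
      ≤ ENNReal.ofReal (δ / (2 * cnt)) := by
  obtain ⟨k, hk, hν1, hν2, hτn⟩ := exists_gap (M := M) (t := t) hb0 hc0 hγ0 hCx n
  rw [← hNdef] at hν1 hν2
  have hk' : (0 : ℝ) < k := by exact_mod_cast hk
  have hN0 : 0 < N := by linarith
  have hsN : 0 < Real.sqrt N := Real.sqrt_pos.2 hN0
  have hsN2 : Real.sqrt N ^ 2 = N := Real.sq_sqrt hN0.le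
  have hn : 1 ≤ n := by
    rcases Nat.eq_zero_or_pos n with h | h
    · exfalso
      rw [h] at hν1
      have : 0 < 2 * N / (1 + b0) := by positivity
      simp at hν1
      linarith
    · exact h
  have hn1 : (1 : ℝ) ≤ n := by exact_mod_cast hn
  set τ := c0 * Real.exp (-(b0 * k) ^ γ0) with hτ
  have hτ0 : 0 ≤ τ := by positivity
  have hV0 : 0 ≤ V0 := by
    have h := (integral_nonneg fun w => sq_nonneg (f w)).trans hvar
    by_contra! hc
    nlinarith [mul_neg_of_neg_of_pos hc (pow_pos hs 2)]
  set a := 1 / (c4 * (Real.sqrt N * s)) with ha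
  have ha0 : 0 < a := by positivity
  have haB : a * B ≤ 1 := by
    rw [ha, one_div, inv_mul_le_iff₀ (by positivity)]; linarith
  have haΛ : a * Λ ≤ 1 := by
    rw [ha, one_div, inv_mul_le_iff₀ (by positivity)]; linarith
  have hm : n ≤ (n / k + 1) * k := by
    have h1 := Nat.div_add_mod n k
    have h2 := Nat.mod_lt n (show k > 0 from hk)
    nlinarith
  have hmr : ((n / k + 1 : ℕ) : ℝ) ≤ n / k + 1 := by
    push_cast
    gcongr
    exact Nat.cast_div_le
  refine (measure_mean_ge_le hz hP hk hΛ ha0 hτ0 (hmix k hk) hB hf hmean hvar haB hm hn _).trans ?_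
  refine ENNReal.ofReal_le_ofReal ?_
  set m : ℝ := ((n / k + 1 : ℕ) : ℝ) with hmdef
  have hm0 : 0 ≤ m := Nat.cast_nonneg _
  set L := Real.log (2 / δ) with hL
  have hL1 : 1 ≤ L := one_le_log_two_div hδ hδ2
  set ν : ℝ := n / k with hν
  -- the number of terms in a class is at most a constant multiple of the effective sample size
  have hmN : m ≤ (3 + b0) * N := by
    refine hmr.trans ?_
    have : 0 ≤ (1 + b0) * N := by positivity
    nlinarith
  have hmτ : m * τ ≤ 2 * (Cx / b0) := by
    have h1 : m ≤ 2 * n := by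
      refine hmr.trans ?_
      have : ν ≤ n := div_le_self (by positivity) (by exact_mod_cast hk)
      linarith
    calc m * τ ≤ 2 * n * τ := by gcongr
      _ = 2 * (n * τ) := by ring
      _ ≤ _ := by gcongr
  have hexp1 : 2 * Q / ((1 + b0) * c4) * L ≤ a * ν * (Q * L * s / Real.sqrt N) := by
    have h1 : a * ν * (Q * L * s / Real.sqrt N) = ν / N * (Q * L / c4) := by
      have h0 : a * ν * (Q * L * s / Real.sqrt N) = ν / Real.sqrt N ^ 2 * (Q * L / c4) := by
        rw [ha]; field_simp
      rw [h0, hsN2]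
    have hQ0 : 0 ≤ Q := by
      have h2 : 0 ≤ 2 * Q / ((1 + b0) * c4) := by
        refine le_trans ?_ hQ
        have := Real.log_nonneg hcnt
        positivity
      by_contra! hc
      have : 2 * Q / ((1 + b0) * c4) < 0 := div_neg_of_neg_of_pos (by linarith) (by positivity)
      linarith
    have h2 : 2 / (1 + b0) ≤ ν / N := by
      rw [le_div_iff₀ hN0]
      calc 2 / (1 + b0) * N = 2 * N / (1 + b0) := by ring
        _ ≤ ν := hν1
    rw [h1]
    calc 2 * Q / ((1 + b0) * c4) * L = 2 / (1 + b0) * (Q * L / c4) := by field_simp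
      _ ≤ ν / N * (Q * L / c4) := by gcongr
  have hexp2 : m * (a ^ 2 * (V0 * s ^ 2) + 3 * a * Λ * τ)
      ≤ (3 + b0) * V0 / c4 ^ 2 + 6 * Cx / b0 := by
    have h1 : m * (a ^ 2 * (V0 * s ^ 2)) ≤ (3 + b0) * V0 / c4 ^ 2 := by
      calc m * (a ^ 2 * (V0 * s ^ 2)) ≤ (3 + b0) * N * (a ^ 2 * (V0 * s ^ 2)) := by gcongr
        _ = (3 + b0) * V0 / c4 ^ 2 := by
            have h0 : (3 + b0) * Real.sqrt N ^ 2 * (a ^ 2 * (V0 * s ^ 2))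
                = (3 + b0) * V0 / c4 ^ 2 := by
              rw [ha]; field_simp
            rw [← h0, hsN2]
    have h2 : m * (3 * a * Λ * τ) ≤ 6 * Cx / b0 := by
      calc m * (3 * a * Λ * τ) = 3 * (a * Λ) * (m * τ) := by ring
        _ ≤ 3 * 1 * (2 * (Cx / b0)) := by gcongr
        _ = _ := by ring
    linarith [mul_add m (a ^ 2 * (V0 * s ^ 2)) (3 * a * Λ * τ)]
  have hE : 0 ≤ (3 + b0) * V0 / c4 ^ 2 + 6 * Cx / b0 := by positivity
  have hlc := Real.log_nonneg hcnt
  have hQ' : 1 + ((3 + b0) * V0 / c4 ^ 2 + 6 * Cx / b0) + Real.log cnt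
      ≤ 2 * Q / ((1 + b0) * c4) := by linarith
  have hfin : -(a * ν * (Q * L * s / Real.sqrt N))
      + m * (a ^ 2 * (V0 * s ^ 2) + 3 * a * Λ * τ) ≤ -L - Real.log cnt := by
    generalize (3 + b0) * V0 / c4 ^ 2 + 6 * Cx / b0 = E at hexp2 hE hQ'
    generalize 2 * Q / ((1 + b0) * c4) = q at hexp1 hQ'
    generalize a * ν * (Q * L * s / Real.sqrt N) = A1 at hexp1 ⊢
    generalize m * (a ^ 2 * (V0 * s ^ 2) + 3 * a * Λ * τ) = A2 at hexp2 ⊢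
    generalize Real.log cnt = lc at hlc hQ' ⊢
    clear_value L
    have h1 := mul_le_mul_of_nonneg_right hQ' (by linarith : (0 : ℝ) ≤ L)
    have h2 := mul_le_mul_of_nonneg_left hL1 (by linarith : 0 ≤ E + lc)
    linarith
  calc _ ≤ Real.exp (-L - Real.log cnt) := Real.exp_le_exp.2 hfin
    _ = δ / (2 * cnt) := by
        rw [Real.exp_sub, Real.exp_neg, hL, Real.exp_log (by positivity),
          Real.exp_log (by linarith)]
        field_simp

/-- Truncation of a real number to `[-B, B]`. The mixing coefficients only see bounded Lipschitz
functions; products of truncated linear functionals are such functions and agree almost surely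
with the products themselves. -/
noncomputable def clip (B u : ℝ) : ℝ := max (-B) (min B u)

theorem abs_clip_le {B : ℝ} (hB : 0 ≤ B) (u : ℝ) : |clip B u| ≤ B := by
  rw [abs_le]
  exact ⟨le_max_left _ _, max_le (by linarith) (min_le_left _ _)⟩

theorem clip_eq {B u : ℝ} (hu : |u| ≤ B) : clip B u = u := by
  rw [abs_le] at hu
  rw [clip, min_eq_right hu.2, max_eq_right hu.1]

theorem abs_clip_sub_clip_le (B u v : ℝ) : |clip B u - clip B v| ≤ |u - v| := by
  rw [clip, clip]
  refine (abs_max_sub_max_le_max _ _ _ _).trans (max_le (by simp) ?_)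
  exact (abs_min_sub_min_le_max _ _ _ _).trans (max_le (by simp) le_rfl)

theorem abs_clip_mul_clip_sub_le {d : ℕ} {φ₁ φ₂ : Obs d → ℝ} {B₁ B₂ Λ₁ Λ₂ : ℝ} (hB₁ : 0 ≤ B₁)
    (hB₂ : 0 ≤ B₂) (h₁ : ∀ w w', |φ₁ w - φ₁ w'| ≤ Λ₁ * obsDist w w')
    (h₂ : ∀ w w', |φ₂ w - φ₂ w'| ≤ Λ₂ * obsDist w w') (w w' : Obs d) :
    |clip B₁ (φ₁ w) * clip B₂ (φ₂ w) - clip B₁ (φ₁ w') * clip B₂ (φ₂ w')|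
      ≤ (B₁ * Λ₂ + B₂ * Λ₁) * obsDist w w' := by
  have e : clip B₁ (φ₁ w) * clip B₂ (φ₂ w) - clip B₁ (φ₁ w') * clip B₂ (φ₂ w')
      = clip B₁ (φ₁ w) * (clip B₂ (φ₂ w) - clip B₂ (φ₂ w'))
        + clip B₂ (φ₂ w') * (clip B₁ (φ₁ w) - clip B₁ (φ₁ w')) := by ring
  rw [e]
  refine (abs_add_le _ _).trans ?_
  rw [abs_mul, abs_mul]
  have k1 := mul_le_mul (abs_clip_le hB₁ (φ₁ w))
    ((abs_clip_sub_clip_le B₂ _ _).trans (h₂ w w')) (abs_nonneg _) hB₁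
  have k2 := mul_le_mul (abs_clip_le hB₂ (φ₂ w'))
    ((abs_clip_sub_clip_le B₁ _ _).trans (h₁ w w')) (abs_nonneg _) hB₂
  linarith

/-- Two-sided deviation of the empirical mean of a product `φ₁ φ₂` of Lipschitz functions that are
almost surely bounded. -/
theorem measure_abs_mean_sub_ge_le {Ω : Type*} [MeasurableSpace Ω] {d : ℕ} {μ : Measure Ω}
    [IsProbabilityMeasure μ] {P : Measure (Obs d)} [IsProbabilityMeasure P] {z : ℕ → Ω → Obs d}
    (hz : ∀ i, Measurable (z i)) (hP : ∀ i, μ.map (z i) = P)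
    {b0 c0 γ0 Cx M t : ℝ} (hb0 : 0 < b0) (hc0 : 0 ≤ c0) (hγ0 : 0 < γ0) (hCx : 0 < Cx)
    (hmix : IsGeomTauMixing μ z b0 c0 γ0)
    {n : ℕ} {N : ℝ} (hNdef : N = effSize b0 c0 γ0 Cx M t n) (hN : 1 ≤ N)
    {B₁ B₂ Λ₁ Λ₂ V0 s c4 Q cnt δ : ℝ} (hδ : 0 < δ) (hδ2 : δ < 1 / 2)
    (hs : 0 < s) (hc4 : 0 < c4) (hcnt : 1 ≤ cnt)
    (hB₁ : 0 < B₁) (hB₂ : 0 < B₂) (hΛ₁ : 0 < Λ₁) (hΛ₂ : 0 < Λ₂)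
    {φ₁ φ₂ : Obs d → ℝ} (h₁ : ∀ w w', |φ₁ w - φ₁ w'| ≤ Λ₁ * obsDist w w')
    (h₂ : ∀ w w', |φ₂ w - φ₂ w'| ≤ Λ₂ * obsDist w w')
    (hb₁ : ∀ᵐ w ∂P, |φ₁ w| ≤ B₁) (hb₂ : ∀ᵐ w ∂P, |φ₂ w| ≤ B₂)
    {c : ℝ} (hc : ∫ w, φ₁ w * φ₂ w ∂P = c)
    (hvar : ∫ w, (φ₁ w * φ₂ w - c) ^ 2 ∂P ≤ V0 * s ^ 2)
    (hBs : 2 * (B₁ * B₂) ≤ c4 * (Real.sqrt N * s))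
    (hΛs : B₁ * Λ₂ + B₂ * Λ₁ ≤ c4 * (Real.sqrt N * s))
    (hQ : 1 + (3 + b0) * V0 / c4 ^ 2 + 6 * Cx / b0 + Real.log cnt ≤ 2 * Q / ((1 + b0) * c4)) :
    μ {ω | Q * Real.log (2 / δ) * s / Real.sqrt N
        ≤ |(1 / (n : ℝ)) * ∑ i ∈ Finset.range n, φ₁ (z i ω) * φ₂ (z i ω) - c|}
      ≤ ENNReal.ofReal (δ / cnt) := by
  set ψ : Obs d → ℝ := fun w => clip B₁ (φ₁ w) * clip B₂ (φ₂ w) with hψ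
  have hψae : ∀ᵐ w ∂P, ψ w = φ₁ w * φ₂ w := by
    filter_upwards [hb₁, hb₂] with w w1 w2
    rw [hψ]; simp only [clip_eq w1, clip_eq w2]
  have hψB : ∀ w, |ψ w| ≤ B₁ * B₂ := fun w => by
    rw [hψ]; simp only [abs_mul]
    exact mul_le_mul (abs_clip_le hB₁.le _) (abs_clip_le hB₂.le _) (abs_nonneg _) hB₁.le
  have hψL := abs_clip_mul_clip_sub_le hB₁.le hB₂.le h₁ h₂
  have hψm : Measurable ψ := measurable_of_obsDist hψL
  have hψint : Integrable ψ P := Integrable.of_bound hψm.aestronglyMeasurable _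
    (Filter.Eventually.of_forall hψB)
  have hψc : ∫ w, ψ w ∂P = c := by rw [← hc]; exact integral_congr_ae hψae
  have hcB : |c| ≤ B₁ * B₂ := by
    rw [← hψc]
    have hψB' : ∀ᵐ w ∂P, ‖ψ w‖ ≤ B₁ * B₂ := Filter.Eventually.of_forall hψB
    simpa using norm_integral_le_of_norm_le_const hψB'
  have hψvar : ∫ w, (ψ w - c) ^ 2 ∂P ≤ V0 * s ^ 2 := by
    refine le_trans (le_of_eq (integral_congr_ae ?_)) hvar
    filter_upwards [hψae] with w hw
    rw [hw]
  have hΛ : 0 < B₁ * Λ₂ + B₂ * Λ₁ := by positivity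
  have hupB : ∀ w, |ψ w - c| ≤ 2 * (B₁ * B₂) := fun w =>
    (abs_sub _ _).trans (by linarith [hψB w])
  have hup := measure_mean_ge_le_effSize (f := fun w => ψ w - c) hz hP hb0 hc0 hγ0 hCx hmix hNdef
    hN hΛ hδ hδ2 hs hc4 hcnt hupB
    (fun w w' => by simpa using hψL w w')
    (by rw [integral_sub hψint (integrable_const c), hψc]; simp) hψvar hBs hΛs hQ
  have hlo := measure_mean_ge_le_effSize (f := fun w => c - ψ w) hz hP hb0 hc0 hγ0 hCx hmix hNdef
    hN hΛ hδ hδ2 hs hc4 hcnt (fun w => by rw [abs_sub_comm]; exact hupB w)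
    (fun w w' => by
      have := hψL w w'
      rw [abs_sub_comm] at this
      simpa using this)
    (by rw [integral_sub (integrable_const c) hψint, hψc]; simp)
    (by
      refine le_trans (le_of_eq ?_) hψvar
      congr 1; ext w; ring) hBs hΛs hQ
  have hae : ∀ᵐ ω ∂μ, ∀ i, ψ (z i ω) = φ₁ (z i ω) * φ₂ (z i ω) := by
    rw [ae_all_iff]
    intro i
    have := hψae
    rw [← hP i] at this
    exact ae_of_ae_map (hz i).aemeasurable this
  have hn : (n : ℝ) ≠ 0 := by
    intro h
    have : N = 0 := by rw [hNdef, effSize, h]; simp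
    linarith
  refine (measure_mono_ae (t := {ω | Q * Real.log (2 / δ) * s / Real.sqrt N
        ≤ (1 / (n : ℝ)) * ∑ i ∈ Finset.range n, (ψ (z i ω) - c)} ∪
      {ω | Q * Real.log (2 / δ) * s / Real.sqrt N
        ≤ (1 / (n : ℝ)) * ∑ i ∈ Finset.range n, (c - ψ (z i ω))}) ?_).trans
    ((measure_union_le _ _).trans ((add_le_add hup hlo).trans (le_of_eq ?_)))
  · filter_upwards [hae] with ω hω
    intro (h : _ ≤ |_|)
    change ω ∈ {ω | _} ∪ {ω | _}
    simp only [← hω] at h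
    have e1 : (1 / (n : ℝ)) * ∑ i ∈ Finset.range n, (ψ (z i ω) - c)
        = (1 / (n : ℝ)) * ∑ i ∈ Finset.range n, ψ (z i ω) - c := by
      rw [Finset.sum_sub_distrib]; simp; field_simp
    have e2 : (1 / (n : ℝ)) * ∑ i ∈ Finset.range n, (c - ψ (z i ω))
        = -((1 / (n : ℝ)) * ∑ i ∈ Finset.range n, ψ (z i ω) - c) := by
      rw [Finset.sum_sub_distrib]; simp; field_simp
    rcases le_abs.1 h with h | h
    · left
      rw [Set.mem_ofPred_eq, e1]; exact h
    · right
      rw [Set.mem_ofPred_eq, e2]; exact h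
  · have hc0' : 0 ≤ δ / (2 * cnt) := by positivity
    rw [← ENNReal.ofReal_add hc0' hc0']
    congr 1
    field_simp
    norm_num

/-! ### The population covariance -/

theorem isHermitian_popCov {d : ℕ} (P : Measure (Obs d)) : (popCov P).IsHermitian := by
  ext a b
  simp [popCov, mul_comm]

theorem integrable_inner_mul {d : ℕ} {P : Measure (Obs d)} [IsFiniteMeasure P] {Cx : ℝ}
    (hCx : ∀ᵐ w ∂P, ‖w.1‖ ≤ Cx) (u v : Feat d) :
    Integrable (fun w : Obs d => inner ℝ w.1 u * inner ℝ w.1 v) P := by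
  refine Integrable.of_bound (C := (Cx * ‖u‖) * (Cx * ‖v‖)) (Continuous.aestronglyMeasurable
    (by fun_prop)) ?_
  filter_upwards [hCx] with w hw
  rw [norm_mul]
  have h0 := (norm_nonneg w.1).trans hw
  exact mul_le_mul ((norm_inner_le_norm _ _).trans (by gcongr))
    ((norm_inner_le_norm _ _).trans (by gcongr)) (norm_nonneg _) (by positivity)

theorem inner_popCov {d : ℕ} {P : Measure (Obs d)} [IsFiniteMeasure P] {Cx : ℝ}
    (hCx : ∀ᵐ w ∂P, ‖w.1‖ ≤ Cx) (u v : Feat d) :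
    inner ℝ u (act (popCov P) v) = ∫ w, inner ℝ w.1 u * inner ℝ w.1 v ∂P := by
  have hint : ∀ a b, Integrable (fun w : Obs d => w.1 a * w.1 b) P := by
    intro a b
    simpa [EuclideanSpace.inner_single_right] using integrable_inner_mul hCx
      (EuclideanSpace.single a (1 : ℝ)) (EuclideanSpace.single b (1 : ℝ))
  have e : ∀ w : Obs d, inner ℝ w.1 u * inner ℝ w.1 v
      = ∑ a, ∑ b, u a * v b * (w.1 a * w.1 b) := by
    intro w
    simp only [PiLp.inner_apply, RCLike.inner_apply, conj_trivial, Finset.sum_mul_sum]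
    refine Finset.sum_congr rfl fun a _ => Finset.sum_congr rfl fun b _ => by ring
  rw [inner_act_eq_sum]
  simp_rw [e]
  rw [integral_finsetSum _ fun a _ => integrable_finsetSum _ fun b _ => (hint a b).const_mul _]
  refine Finset.sum_congr rfl fun a _ => ?_
  rw [integral_finsetSum _ fun b _ => (hint a b).const_mul _]
  refine Finset.sum_congr rfl fun b _ => ?_
  rw [integral_const_mul, popCov, Matrix.of_apply]; ring

theorem posSemidef_popCov {d : ℕ} {P : Measure (Obs d)} [IsFiniteMeasure P] {Cx : ℝ}
    (hCx : ∀ᵐ w ∂P, ‖w.1‖ ≤ Cx) : (popCov P).PosSemidef := by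
  refine posSemidef_of_inner_act_nonneg (isHermitian_popCov P) fun v => ?_
  rw [inner_popCov hCx]
  exact integral_nonneg fun w => mul_self_nonneg _

theorem eigenvalues_popCov_le {d : ℕ} {P : Measure (Obs d)} [IsProbabilityMeasure P] {Cx : ℝ}
    (hCx : ∀ᵐ w ∂P, ‖w.1‖ ≤ Cx) (j : Fin d) :
    (isHermitian_popCov P).eigenvalues j ≤ Cx ^ 2 := by
  refine eigenvalues_le_of_inner_act_le _ (fun v => ?_) j
  rw [inner_popCov hCx]
  have : ∫ w, inner ℝ w.1 v * inner ℝ w.1 v ∂P ≤ ∫ _w, Cx ^ 2 * ‖v‖ ^ 2 ∂P := by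
    refine integral_mono_ae (integrable_inner_mul hCx v v) (integrable_const _) ?_
    filter_upwards [hCx] with w hw
    rw [← sq, ← mul_pow, ← sq_abs]
    exact pow_le_pow_left₀ (abs_nonneg _) ((abs_real_inner_le_norm _ _).trans (by gcongr)) 2
  simpa using this

theorem integral_residual_mul_inner {d : ℕ} {P : Measure (Obs d)} [IsProbabilityMeasure P]
    {Cx M : ℝ} (hbd : ∀ᵐ w ∂P, ‖w.1‖ ≤ Cx ∧ |w.2| ≤ M) {θ : Feat d}
    (hreg : P[fun w => w.2 | MeasurableSpace.comap Prod.fst inferInstance]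
          =ᵐ[P] (fun w => inner ℝ w.1 θ)) (v : Feat d) :
    ∫ w, (w.2 - inner ℝ w.1 θ) * inner ℝ w.1 v ∂P = 0 := by
  have hCx : ∀ᵐ w ∂P, ‖w.1‖ ≤ Cx := hbd.mono fun w hw => hw.1
  have hy : Integrable (fun w : Obs d => w.2) P :=
    Integrable.of_bound measurable_snd.aestronglyMeasurable M (hbd.mono fun w hw => hw.2)
  have hvy : Integrable ((fun w : Obs d => inner ℝ w.1 v) * fun w => w.2) P := by
    refine hy.bdd_mul (Continuous.aestronglyMeasurable (by fun_prop)) (c := Cx * ‖v‖) ?_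
    filter_upwards [hCx] with w hw
    exact (norm_inner_le_norm _ _).trans (by gcongr)
  have hm : StronglyMeasurable[MeasurableSpace.comap Prod.fst inferInstance]
      (fun w : Obs d => (inner ℝ w.1 v : ℝ)) := by
    refine Measurable.stronglyMeasurable ?_
    have : Measurable (fun x : Feat d => (inner ℝ x v : ℝ)) :=
      Continuous.measurable (by fun_prop)
    exact this.comp (comap_measurable Prod.fst)
  have hpull := condExp_mul_of_stronglyMeasurable_left hm hvy hy
  have h1 : ∫ w, inner ℝ w.1 v * w.2 ∂P = ∫ w, inner ℝ w.1 v * inner ℝ w.1 θ ∂P := by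
    calc ∫ w, inner ℝ w.1 v * w.2 ∂P
        = ∫ w, (P[(fun w : Obs d => inner ℝ w.1 v) * fun w => w.2 |
            MeasurableSpace.comap Prod.fst inferInstance]) w ∂P :=
          (integral_condExp measurable_fst.comap_le).symm
      _ = _ := by
          refine integral_congr_ae (hpull.trans ?_)
          filter_upwards [hreg] with w hw
          simp only [Pi.mul_apply]
          rw [hw]
  have e : ∀ w : Obs d, (w.2 - inner ℝ w.1 θ) * inner ℝ w.1 v
      = inner ℝ w.1 v * w.2 - inner ℝ w.1 v * inner ℝ w.1 θ := fun w => by ring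
  simp_rw [e]
  have hvy' : Integrable (fun w : Obs d => inner ℝ w.1 v * w.2) P := hvy
  rw [integral_sub hvy' (integrable_inner_mul hCx v θ), h1, sub_self]

/-! ### The favourable event -/

theorem abs_inner_act_le {d : ℕ} {A : Matrix (Fin d) (Fin d) ℝ} {t : ℝ}
    (h : ∀ a b, |A a b| ≤ t) (v : Feat d) : |inner ℝ v (act A v)| ≤ d * t * ‖v‖ ^ 2 := by
  rcases isEmpty_or_nonempty (Fin d) with he | ⟨⟨a0⟩⟩
  · rw [inner_act_eq_sum]; simp; rw [Subsingleton.elim v 0]; simp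
  have ht : 0 ≤ t := (abs_nonneg _).trans (h a0 a0)
  rw [inner_act_eq_sum]
  calc |∑ a, ∑ b, v a * A a b * v b| ≤ ∑ a, ∑ b, |v a| * t * |v b| := by
        refine (Finset.abs_sum_le_sum_abs _ _).trans (Finset.sum_le_sum fun a _ => ?_)
        refine (Finset.abs_sum_le_sum_abs _ _).trans (Finset.sum_le_sum fun b _ => ?_)
        rw [abs_mul, abs_mul]
        gcongr
        exact h a b
    _ = t * (∑ a, |v a|) ^ 2 := by
        rw [sq, Finset.sum_mul_sum, Finset.mul_sum]
        refine Finset.sum_congr rfl fun a _ => ?_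
        rw [Finset.mul_sum]
        exact Finset.sum_congr rfl fun b _ => by ring
    _ ≤ t * (d * ∑ a, |v a| ^ 2) := by
        gcongr
        simpa using sq_sum_le_card_mul_sum_sq (s := Finset.univ) (f := fun a => |v a|)
    _ = d * t * ‖v‖ ^ 2 := by
        rw [EuclideanSpace.norm_sq_eq]
        simp only [Real.norm_eq_abs]
        ring

/-- Control of a vector along the eigenbasis of `S` gives the dual form of a bound on
`‖(S + lam)^{-1/2} ξ‖`. -/
theorem inner_sq_le_of_eigenvectorBasis {d : ℕ} {S : Matrix (Fin d) (Fin d) ℝ}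
    (hS : S.PosSemidef) {lam t : ℝ} (hlam : 0 < lam) {ξ : Feat d}
    (h : ∀ j, |inner ℝ (hS.1.eigenvectorBasis j) ξ|
      ≤ t * Real.sqrt (hS.1.eigenvalues j + lam)) (u : Feat d) :
    inner ℝ ξ u ^ 2 ≤ d * t ^ 2 * (inner ℝ u (act S u) + lam * ‖u‖ ^ 2) := by
  rw [inner_eq_sum hS.1.eigenvectorBasis ξ u, inner_act_self_eq_sum hS.1,
    norm_sq_eq_sum hS.1.eigenvectorBasis u, Finset.mul_sum, ← Finset.sum_add_distrib]
  refine (sq_sum_le_card_mul_sum_sq).trans ?_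
  rw [Finset.card_univ, Fintype.card_fin, mul_assoc]
  refine mul_le_mul_of_nonneg_left ?_ (Nat.cast_nonneg d)
  rw [Finset.mul_sum]
  refine Finset.sum_le_sum fun j _ => ?_
  have hj := hS.eigenvalues_nonneg j
  have h1 : inner ℝ (hS.1.eigenvectorBasis j) ξ ^ 2 ≤ t ^ 2 * (hS.1.eigenvalues j + lam) := by
    have := pow_le_pow_left₀ (abs_nonneg _) (h j) 2
    rwa [sq_abs, mul_pow, Real.sq_sqrt (by linarith)] at this
  rw [mul_pow]
  nlinarith [mul_le_mul_of_nonneg_right h1 (sq_nonneg (inner ℝ (hS.1.eigenvectorBasis j) u))]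

theorem abs_inner_sub_le_obsDist {d : ℕ} (v : Feat d) (w w' : Obs d) :
    |(inner ℝ w.1 v : ℝ) - inner ℝ w'.1 v| ≤ ‖v‖ * obsDist w w' := by
  rw [← inner_sub_left, mul_comm]
  exact (abs_real_inner_le_norm _ _).trans (by gcongr; exact norm_fst_sub_le_obsDist w w')

/-- Outside an event of probability at most `δ` the empirical covariance is close to the population
covariance, and the noise `Ê[XY] - Σ̂ θ` is small relative to `(Σ + lam0)^{1/2}`. The constant
`Q` depends on the dimension through a union bound over coordinates. -/
theorem exists_deviation_const (d : ℕ) (hd : 1 ≤ d) {b0 Cx M ρ κ₁ : ℝ} (hb0 : 0 < b0)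
    (hCx : 0 < Cx) (hM : 0 < M) (hρ : 0 ≤ ρ) (hκ₁ : 0 < κ₁) :
    ∃ Q : ℝ, 0 < Q ∧ ∀ {Ω : Type u} [MeasurableSpace Ω] {μ : Measure Ω} [IsProbabilityMeasure μ]
      {P : Measure (Obs d)} [IsProbabilityMeasure P] {z : ℕ → Ω → Obs d} {θ : Feat d}
      {c0 γ0 : ℝ}, 0 ≤ c0 → 0 < γ0 → (∀ i, Measurable (z i)) → (∀ i, μ.map (z i) = P) →
      P[fun w => w.2 | MeasurableSpace.comap Prod.fst inferInstance]
        =ᵐ[P] (fun w => inner ℝ w.1 θ) →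
      IsGeomTauMixing μ z b0 c0 γ0 → (∀ᵐ w ∂P, ‖w.1‖ ≤ Cx ∧ |w.2| ≤ M) → ‖θ‖ ≤ ρ →
      ∀ {n : ℕ} {N δ lam0 : ℝ}, N = effSize b0 c0 γ0 Cx M ‖θ‖ n → 1 ≤ N → 0 < δ → δ < 1 / 2 →
      0 < lam0 → κ₁ ≤ lam0 * N →
      ∃ E : Set Ω, μ E ≤ ENNReal.ofReal δ ∧ ∀ ω ∉ E,
        (∀ i, ‖(z i ω).1‖ ≤ Cx) ∧
        (∀ v, inner ℝ v (act (popCov P) v)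
          ≤ inner ℝ v (act (empCov fun i : Fin n => z i ω) v)
            + Q * Real.log (2 / δ) / Real.sqrt N * ‖v‖ ^ 2) ∧
        ∀ u, inner ℝ (empCross (fun i : Fin n => z i ω)
            - act (empCov fun i : Fin n => z i ω) θ) u ^ 2
          ≤ (Q * Real.log (2 / δ) / Real.sqrt N) ^ 2
            * (inner ℝ u (act (popCov P) u) + lam0 * ‖u‖ ^ 2) := by
  set B₁ := M + Cx * ρ with hB₁
  have hB₁0 : 0 < B₁ := by positivity
  set Λ₁ := 1 + ρ with hΛ₁
  have hΛ₁0 : 0 < Λ₁ := by positivity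
  set W := 2 * (Cx * Cx) + (Cx * 1 + Cx * 1) + 2 * (B₁ * Cx) + (B₁ * 1 + Cx * Λ₁) with hW
  have hW0 : 0 < W := by positivity
  set c4 := (1 + 1 / Real.sqrt κ₁) * W with hc4
  have hsκ : 0 < Real.sqrt κ₁ := Real.sqrt_pos.2 hκ₁
  have hc40 : 0 < c4 := by positivity
  set V0 := (2 * (Cx * Cx)) ^ 2 + B₁ ^ 2 with hV0
  set cnt : ℝ := d * d + d with hcnt
  have hd' : (1 : ℝ) ≤ d := by exact_mod_cast hd
  have hcnt1 : 1 ≤ cnt := by nlinarith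
  set Q₁ := (1 + (3 + b0) * V0 / c4 ^ 2 + 6 * Cx / b0 + Real.log cnt) * ((1 + b0) * c4) / 2
    with hQ₁
  have hQ₁0 : 0 < Q₁ := by
    have := Real.log_nonneg hcnt1
    positivity
  have hQ : 1 + (3 + b0) * V0 / c4 ^ 2 + 6 * Cx / b0 + Real.log cnt
      ≤ 2 * Q₁ / ((1 + b0) * c4) := by
    refine le_of_eq ?_
    rw [hQ₁]; field_simp
  clear_value Q₁ cnt V0 c4 W Λ₁ B₁
  refine ⟨d * Q₁, by positivity, ?_⟩
  intro Ω _ μ _ P _ z θ c0 γ0 hc0 hγ0 hz hP hreg hmix hbd hθ n N δ lam0 hNdef hN hδ hδ2 hlam0 hκN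
  have hCxP : ∀ᵐ w ∂P, ‖w.1‖ ≤ Cx := hbd.mono fun w hw => hw.1
  have hS := posSemidef_popCov hCxP
  set σ := hS.1.eigenvalues with hσ
  set f := hS.1.eigenvectorBasis with hf
  have hσ0 : ∀ j, 0 ≤ σ j := hS.eigenvalues_nonneg
  have hsN : 1 ≤ Real.sqrt N := Real.one_le_sqrt.2 hN
  have hfn : ∀ j, ‖f j‖ = 1 := fun j => by simp
  set L := Real.log (2 / δ) with hL
  have hW1 : W ≤ c4 := by
    rw [hc4]
    exact le_mul_of_one_le_left hW0.le (le_add_of_nonneg_right (by positivity))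
  have hW2 : ∀ j, W ≤ c4 * (Real.sqrt N * Real.sqrt (σ j + lam0)) := by
    intro j
    have h1 : Real.sqrt κ₁ ≤ Real.sqrt N * Real.sqrt (σ j + lam0) := by
      rw [← Real.sqrt_mul (by linarith)]
      refine Real.sqrt_le_sqrt (hκN.trans ?_)
      rw [mul_comm]
      exact mul_le_mul_of_nonneg_left (le_add_of_nonneg_left (hσ0 j)) (by linarith)
    calc W = 1 / Real.sqrt κ₁ * W * Real.sqrt κ₁ := by field_simp
      _ ≤ c4 * Real.sqrt κ₁ := by
          rw [hc4]
          gcongr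
          exact le_add_of_nonneg_left zero_le_one
      _ ≤ _ := by gcongr
  -- entries of the covariance are means of products of coordinates, with variance at most `V0`
  set x : Fin d → Obs d → ℝ := fun a w => w.1 a with hx
  have hxL : ∀ a w w', |x a w - x a w'| ≤ 1 * obsDist w w' := by
    intro a w w'
    have := abs_inner_sub_le_obsDist (EuclideanSpace.single a (1 : ℝ)) w w'
    simpa [EuclideanSpace.inner_single_right] using this
  have hxB : ∀ a, ∀ᵐ w ∂P, |x a w| ≤ Cx := by
    intro a
    filter_upwards [hCxP] with w hw
    exact (PiLp.norm_apply_le w.1 a).trans hw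
  have hxvar : ∀ a b, ∫ w, (x a w * x b w - popCov P a b) ^ 2 ∂P ≤ V0 * 1 ^ 2 := by
    intro a b
    have hxx : ∀ᵐ w ∂P, ‖x a w * x b w‖ ≤ Cx * Cx := by
      filter_upwards [hxB a, hxB b] with w h1 h2
      rw [norm_mul]
      exact mul_le_mul h1 h2 (norm_nonneg _) hCx.le
    have hc : |popCov P a b| ≤ Cx * Cx := by
      have h := norm_integral_le_of_norm_le_const hxx
      rwa [probReal_univ, mul_one] at h
    have h1 : ∫ w, (x a w * x b w - popCov P a b) ^ 2 ∂P ≤ ∫ _w, (2 * (Cx * Cx)) ^ 2 ∂P := by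
      refine integral_mono_of_nonneg (Filter.Eventually.of_forall fun w => sq_nonneg _)
        (integrable_const _) ?_
      filter_upwards [hxx] with w hw
      rw [← sq_abs]
      refine pow_le_pow_left₀ (abs_nonneg _) ((abs_sub _ _).trans ?_) 2
      rw [Real.norm_eq_abs] at hw
      linarith
    have h2 : ∫ _w, (2 * (Cx * Cx)) ^ 2 ∂P = (2 * (Cx * Cx)) ^ 2 := by simp
    rw [one_pow, mul_one, hV0]
    exact (h1.trans_eq h2).trans (le_add_of_nonneg_right (sq_nonneg _))
  have hcov : ∀ a b, μ {ω | Q₁ * L * 1 / Real.sqrt N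
        ≤ |(1 / (n : ℝ)) * ∑ i ∈ Finset.range n, x a (z i ω) * x b (z i ω) - popCov P a b|}
      ≤ ENNReal.ofReal (δ / cnt) := by
    intro a b
    have hWW : W ≤ c4 * (Real.sqrt N * 1) := by
      rw [mul_one]
      exact hW1.trans (le_mul_of_one_le_right hc40.le hsN)
    refine measure_abs_mean_sub_ge_le hz hP hb0 hc0 hγ0 hCx hmix hNdef hN hδ hδ2 one_pos hc40
      hcnt1 hCx hCx one_pos one_pos (hxL a) (hxL b) (hxB a) (hxB b) rfl (hxvar a b)
      (le_trans ?_ hWW) (le_trans ?_ hWW) hQ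
    · rw [hW]; have : 0 ≤ 2 * (B₁ * Cx) + (B₁ * 1 + Cx * Λ₁) := by positivity
      linarith
    · rw [hW]; have : 0 ≤ 2 * (Cx * Cx) + 2 * (B₁ * Cx) + (B₁ * 1 + Cx * Λ₁) := by positivity
      linarith
  -- along an eigenvector of `Σ` the noise has variance of order the eigenvalue, which is what
  -- makes its deviation comparable to `√(σ + lam0)`
  set res : Obs d → ℝ := fun w => w.2 - inner ℝ w.1 θ with hres
  have hresL : ∀ w w', |res w - res w'| ≤ Λ₁ * obsDist w w' := by
    intro w w'
    have e : res w - res w' = (w.2 - w'.2) - (inner ℝ w.1 θ - inner ℝ w'.1 θ) := by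
      rw [hres]; ring
    rw [e]
    have h0 : 0 ≤ obsDist w w' := Real.sqrt_nonneg _
    have h1 := abs_inner_sub_le_obsDist θ w w'
    have h2 := abs_snd_sub_le_obsDist w w'
    have h3 := mul_le_mul_of_nonneg_right hθ h0
    refine (abs_sub _ _).trans ?_
    rw [hΛ₁]; linarith
  have hresB : ∀ᵐ w ∂P, |res w| ≤ B₁ := by
    filter_upwards [hbd] with w hw
    rw [hB₁]
    refine (abs_sub _ _).trans (add_le_add hw.2 ((abs_real_inner_le_norm _ _).trans ?_))
    exact mul_le_mul hw.1 hθ (norm_nonneg _) hCx.le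
  have hfL : ∀ j w w', |(inner ℝ w.1 (f j) : ℝ) - inner ℝ w'.1 (f j)| ≤ 1 * obsDist w w' := by
    intro j w w'
    have := abs_inner_sub_le_obsDist (f j) w w'
    rwa [hfn] at this
  have hfB : ∀ j, ∀ᵐ w ∂P, |(inner ℝ w.1 (f j) : ℝ)| ≤ Cx := by
    intro j
    filter_upwards [hCxP] with w hw
    have := abs_real_inner_le_norm w.1 (f j)
    rw [hfn, mul_one] at this
    exact this.trans hw
  have hnvar : ∀ j, ∫ w, (res w * inner ℝ w.1 (f j) - 0) ^ 2 ∂P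
      ≤ V0 * Real.sqrt (σ j + lam0) ^ 2 := by
    intro j
    have hσj : ∫ w, inner ℝ w.1 (f j) * inner ℝ w.1 (f j) ∂P = σ j := by
      rw [← inner_popCov hCxP, act_eigenvectorBasis hS.1, real_inner_smul_right,
        real_inner_self_eq_norm_sq]
      change σ j * ‖f j‖ ^ 2 = σ j
      rw [hfn]; ring
    have h1 : ∫ w, (res w * inner ℝ w.1 (f j) - 0) ^ 2 ∂P
        ≤ ∫ w, B₁ ^ 2 * (inner ℝ w.1 (f j) * inner ℝ w.1 (f j)) ∂P := by
      refine integral_mono_of_nonneg (Filter.Eventually.of_forall fun w => sq_nonneg _)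
        ((integrable_inner_mul hCxP _ _).const_mul _) ?_
      filter_upwards [hresB] with w hw
      have h2 : res w ^ 2 ≤ B₁ ^ 2 := by
        rw [← sq_abs]; exact pow_le_pow_left₀ (abs_nonneg _) hw 2
      have h3 := mul_le_mul_of_nonneg_right h2 (mul_self_nonneg (inner ℝ w.1 (f j)))
      linarith [show (res w * inner ℝ w.1 (f j) - 0) ^ 2
        = res w ^ 2 * (inner ℝ w.1 (f j) * inner ℝ w.1 (f j)) by ring]
    rw [integral_const_mul, hσj] at h1
    rw [Real.sq_sqrt (by linarith [hσ0 j])]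
    refine h1.trans ?_
    have h4 : B₁ ^ 2 ≤ V0 := by
      rw [hV0]; exact le_add_of_nonneg_left (sq_nonneg _)
    exact mul_le_mul h4 (le_add_of_nonneg_right hlam0.le) (hσ0 j) ((sq_nonneg _).trans h4)
  have hnoise : ∀ j, μ {ω | Q₁ * L * Real.sqrt (σ j + lam0) / Real.sqrt N
        ≤ |(1 / (n : ℝ)) * ∑ i ∈ Finset.range n, res (z i ω) * inner ℝ (z i ω).1 (f j) - 0|}
      ≤ ENNReal.ofReal (δ / cnt) := by
    intro j
    refine measure_abs_mean_sub_ge_le (φ₁ := res) (φ₂ := fun w => inner ℝ w.1 (f j)) hz hP hb0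
      hc0 hγ0 hCx hmix hNdef hN hδ hδ2
      (Real.sqrt_pos.2 (by linarith [hσ0 j])) hc40 hcnt1 hB₁0 hCx hΛ₁0 one_pos hresL (hfL j)
      hresB (hfB j) (integral_residual_mul_inner hbd hreg _) (hnvar j)
      (le_trans ?_ (hW2 j)) (le_trans ?_ (hW2 j)) hQ
    · rw [hW]
      have : 0 ≤ 2 * (Cx * Cx) + (Cx * 1 + Cx * 1) + (B₁ * 1 + Cx * Λ₁) := by positivity
      linarith
    · rw [hW]
      have : 0 ≤ 2 * (Cx * Cx) + (Cx * 1 + Cx * 1) + 2 * (B₁ * Cx) := by positivity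
      linarith
  have hae : ∀ᵐ ω ∂μ, ∀ i, ‖(z i ω).1‖ ≤ Cx := by
    rw [ae_all_iff]
    intro i
    have := hCxP
    rw [← hP i] at this
    exact ae_of_ae_map (hz i).aemeasurable this
  refine ⟨{ω | ¬ ∀ i, ‖(z i ω).1‖ ≤ Cx} ∪
    ((⋃ ab : Fin d × Fin d, {ω | Q₁ * L * 1 / Real.sqrt N
        ≤ |(1 / (n : ℝ)) * ∑ i ∈ Finset.range n, x ab.1 (z i ω) * x ab.2 (z i ω)
            - popCov P ab.1 ab.2|}) ∪
      ⋃ j : Fin d, {ω | Q₁ * L * Real.sqrt (σ j + lam0) / Real.sqrt N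
        ≤ |(1 / (n : ℝ)) * ∑ i ∈ Finset.range n, res (z i ω) * inner ℝ (z i ω).1 (f j) - 0|}),
    ?_, ?_⟩
  · refine (measure_union_le _ _).trans ?_
    rw [ae_iff.1 hae, zero_add]
    refine (measure_union_le _ _).trans ?_
    refine (add_le_add ((measure_iUnion_fintype_le _ _).trans
      (Finset.sum_le_sum fun ab _ => hcov ab.1 ab.2))
      ((measure_iUnion_fintype_le _ _).trans (Finset.sum_le_sum fun j _ => hnoise j))).trans ?_
    have hcnt' : ((d * d + d : ℕ) : ENNReal) * ENNReal.ofReal (δ / cnt) = ENNReal.ofReal δ := by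
      rw [← ENNReal.ofReal_natCast, ← ENNReal.ofReal_mul (Nat.cast_nonneg _)]
      congr 1
      push_cast
      rw [← hcnt]
      field_simp
    refine le_of_eq ?_
    rw [← hcnt']
    simp
    ring
  · intro ω hω
    simp only [Set.mem_union, Set.mem_iUnion, Set.mem_ofPred_eq, not_or, not_exists, not_not,
      not_le, Prod.forall] at hω
    obtain ⟨hω0, hω1, hω2⟩ := hω
    set D : Fin n → Obs d := fun i => z i ω with hD
    have hL0 : 0 ≤ L := by linarith [one_le_log_two_div hδ hδ2]
    refine ⟨hω0, fun v => ?_, fun u => ?_⟩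
    · have hent : ∀ a b, |(popCov P - empCov D) a b| ≤ Q₁ * L * 1 / Real.sqrt N := by
        intro a b
        have e : empCov D a b
            = (1 / (n : ℝ)) * ∑ i ∈ Finset.range n, x a (z i ω) * x b (z i ω) := by
          rw [Finset.sum_range]
          simp [empCov, Matrix.sum_apply, Matrix.vecMulVec_apply, hx, hD]
        rw [Matrix.sub_apply, abs_sub_comm, e]
        exact (hω1 a b).le
      have h1 := (abs_le.1 (abs_inner_act_le hent v)).2
      rw [sub_act, inner_sub_right] at h1
      have e2 : d * (Q₁ * L * 1 / Real.sqrt N) * ‖v‖ ^ 2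
          = d * Q₁ * L / Real.sqrt N * ‖v‖ ^ 2 := by ring
      linarith
    · have h1 : ∀ j, |inner ℝ (hS.1.eigenvectorBasis j) (empCross D - act (empCov D) θ)|
          ≤ Q₁ * L / Real.sqrt N * Real.sqrt (hS.1.eigenvalues j + lam0) := by
        intro j
        have e : inner ℝ (hS.1.eigenvectorBasis j) (empCross D - act (empCov D) θ)
            = (1 / (n : ℝ)) * ∑ i ∈ Finset.range n,
              res (z i ω) * inner ℝ (z i ω).1 (f j) - 0 := by
          rw [inner_sub_right, real_inner_comm, inner_empCross, inner_empCov, ← mul_sub,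
            ← Finset.sum_sub_distrib, Finset.sum_range, sub_zero]
          congr 1
          refine Finset.sum_congr rfl fun i _ => ?_
          simp only [hres, hD, ← hf]
          ring
        rw [e]
        refine (hω2 j).le.trans (le_of_eq ?_)
        change _ = Q₁ * L / Real.sqrt N * Real.sqrt (σ j + lam0)
        ring
      refine (inner_sq_le_of_eigenvectorBasis hS hlam0 h1 u).trans ?_
      have h2 : 0 ≤ inner ℝ u (act (popCov P) u) + lam0 * ‖u‖ ^ 2 := by
        have : 0 ≤ inner ℝ u (act (popCov P) u) := by
          rw [inner_popCov hCxP]; exact integral_nonneg fun w => mul_self_nonneg _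
        positivity
      refine mul_le_mul_of_nonneg_right ?_ h2
      have e3 : (d * Q₁ * L / Real.sqrt N) ^ 2 = d * (d * (Q₁ * L / Real.sqrt N) ^ 2) := by ring
      rw [e3]
      gcongr
      exact le_mul_of_one_le_left (sq_nonneg _) hd'

/-! ### The selection rule -/

theorem effSize_le_mul_ellThree {b0 c0 γ0 Cx M t : ℝ} (hb0 : 0 < b0) (hc0 : 0 ≤ c0) (hγ0 : 0 < γ0)
    (hCx : 0 < Cx) {d : ℕ} (hd : 1 ≤ d) (n : ℕ) :
    effSize b0 c0 γ0 Cx M t n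
      ≤ (1 + Real.log (2 * Real.sqrt d)) ^ (1 / γ0) * ellThree b0 c0 γ0 Cx d n := by
  rw [effSize, ellThree]
  set mx := max (Real.sqrt 2 * max (M + 2 * Cx * t) Cx / (2 * Cx * M)) (1 / Cx) with hmx
  have hmx1 : 1 / Cx ≤ mx := le_max_right _ _
  set G := max 1 (Real.log (c0 * b0 * mx * n)) with hG
  set G' := max 1 (Real.log (b0 * c0 * n * (2 * Real.sqrt d / Cx))) with hG'
  have hG1 : 1 ≤ G := le_max_left _ _
  have hG1' : 1 ≤ G' := le_max_left _ _
  have hd' : (1 : ℝ) ≤ Real.sqrt d := Real.one_le_sqrt.2 (by exact_mod_cast hd)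
  have hl : 0 ≤ Real.log (2 * Real.sqrt d) := Real.log_nonneg (by linarith)
  have hn0 : (0 : ℝ) ≤ n := Nat.cast_nonneg n
  have hGG : G' ≤ (1 + Real.log (2 * Real.sqrt d)) * G := by
    refine max_le (by nlinarith) ?_
    rcases (mul_nonneg hn0 hc0).eq_or_lt with h0 | h0
    · have : b0 * c0 * n * (2 * Real.sqrt d / Cx) = 0 := by
        rw [show b0 * c0 * n * (2 * Real.sqrt d / Cx) = n * c0 * (b0 * (2 * Real.sqrt d / Cx)) by
          ring, ← h0, zero_mul]
      rw [this, Real.log_zero]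
      positivity
    · have h1 : b0 * c0 * n * (2 * Real.sqrt d / Cx)
          = (n * c0 * (b0 * (1 / Cx))) * (2 * Real.sqrt d) := by field_simp
      have h2 : n * c0 * (b0 * (1 / Cx)) ≤ c0 * b0 * mx * n := by
        calc n * c0 * (b0 * (1 / Cx)) ≤ n * c0 * (b0 * mx) := by gcongr
          _ = _ := by ring
      have hpos : 0 < n * c0 * (b0 * (1 / Cx)) := by positivity
      rw [h1, Real.log_mul hpos.ne' (by positivity)]
      have h3 := (Real.log_le_log hpos h2).trans (le_max_right 1 _ : _ ≤ G)
      nlinarith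
  have hH : 0 < 1 + Real.log (2 * Real.sqrt d) := by linarith
  have h4 : G' ^ (1 / γ0) ≤ (1 + Real.log (2 * Real.sqrt d)) ^ (1 / γ0) * G ^ (1 / γ0) := by
    rw [← Real.mul_rpow hH.le (by linarith)]
    exact Real.rpow_le_rpow (by linarith) hGG (by positivity)
  have hg : 0 < G ^ (1 / γ0) := Real.rpow_pos_of_pos (by linarith) _
  have hg' : 0 < G' ^ (1 / γ0) := Real.rpow_pos_of_pos (by linarith) _
  rw [← mul_div_assoc, div_le_div_iff₀ (by positivity) (by positivity)]
  have : 0 ≤ n * b0 := by positivity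
  nlinarith [mul_le_mul_of_nonneg_left h4 this]

/-- In dimension `d` the quantity `W_{D, lam}` is of order `N ^ (-1/2)` as soon as `lam N` is
bounded below. -/
theorem wTerm_le {d n : ℕ} (hd : 1 ≤ d) {Cx N ell lam H κ₁ : ℝ} (D : Fin n → Obs d) (hCx : 0 < Cx)
    (hN : 1 ≤ N) (hlam : 0 < lam) (hH : 0 < H) (hκ₁ : 0 < κ₁) (hκN : κ₁ ≤ lam * N)
    (hell : N ≤ H * ell) :
    wTerm Cx N ell D lam
      ≤ ((1 + 4 * (13 * Cx / Real.sqrt (κ₁ / H) + 21 * Cx ^ 2 / (κ₁ / H))) * Real.sqrt d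
          + 1 / Real.sqrt κ₁) / Real.sqrt N := by
  have hN0 : 0 < N := by linarith
  have hlell : κ₁ / H ≤ lam * ell := by
    rw [div_le_iff₀ hH]
    calc κ₁ ≤ lam * N := hκN
      _ ≤ lam * (H * ell) := by gcongr
      _ = _ := by ring
  have hd' : (1 : ℝ) ≤ Real.sqrt d := Real.one_le_sqrt.2 (by exact_mod_cast hd)
  have hmax : max (Real.sqrt (effDim (empCov D) lam)) 1 ≤ Real.sqrt d :=
    max_le (Real.sqrt_le_sqrt (effDim_le (posSemidef_empCov D) hlam)) hd'
  have hsec : 1 / (N * Real.sqrt lam) ≤ 1 / Real.sqrt κ₁ / Real.sqrt N := by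
    have e : N * Real.sqrt lam = Real.sqrt (lam * N) * Real.sqrt N := by
      rw [Real.sqrt_mul hlam.le, mul_assoc, Real.mul_self_sqrt hN0.le, mul_comm]
    rw [e, div_div]
    gcongr
  rw [wTerm, add_div]
  gcongr

theorem kHat_spec {d n : ℕ} (g : ℝ → ℝ → ℝ) (b ct Cx M δ q q0 N ell : ℝ) {K : ℕ} (hK : 1 ≤ K)
    (D : Fin n → Obs d) :
    kHat g b ct Cx M δ q q0 N ell K D ≤ K + 1 ∧ 1 ≤ kHat g b ct Cx M δ q q0 N ell K D ∧
      ∀ k, kHat g b ct Cx M δ q q0 N ell K D ≤ k → k < K →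
        ¬ Exceeds g b ct Cx M δ q q0 N ell D k := by
  classical
  rw [kHat]
  have hle : firstExceed g b ct Cx M δ q q0 N ell K D ≤ K := Nat.findGreatest_le K
  split_ifs with h
  · exact ⟨by omega, hK, fun k h1 h2 => by omega⟩
  · refine ⟨by omega, by omega, fun k h1 h2 hE => ?_⟩
    exact Nat.findGreatest_is_greatest (P := fun k => 1 ≤ k ∧ Exceeds g b ct Cx M δ q q0 N ell D k)
      (show firstExceed g b ct Cx M δ q q0 N ell K D < k by omega) h2.le ⟨by omega, hE⟩

theorem gridSize_spec {q q0 csa N : ℝ} (hq0 : 0 < q) (hq1 : q < 1) (hq00 : 0 < q0) (hcsa : 0 < csa)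
    (hN : 0 ≤ N) (hK : 1 ≤ gridSize q q0 csa N) :
    0 < N ∧ csa / Real.sqrt N ≤ gridPt q q0 (gridSize q q0 csa N) ∧
      q * gridPt q q0 (gridSize q q0 csa N) ≤ csa / Real.sqrt N ∧
      (gridSize q q0 csa N : ℝ) ≤ Real.logb q (csa / (q0 * Real.sqrt N)) := by
  have hlog : 1 ≤ Real.logb q (csa / (q0 * Real.sqrt N)) := by
    rw [gridSize, Nat.one_le_floor_iff] at hK
    exact hK
  have hN0 : 0 < N := by
    rcases hN.eq_or_lt with h | h
    · rw [← h] at hlog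
      simp at hlog
      linarith
    · exact h
  have hsN : 0 < Real.sqrt N := Real.sqrt_pos.2 hN0
  have hx : 0 < csa / (q0 * Real.sqrt N) := by positivity
  have h1 : (gridSize q q0 csa N : ℝ) ≤ Real.logb q (csa / (q0 * Real.sqrt N)) :=
    Nat.floor_le (by linarith)
  have h2 : Real.logb q (csa / (q0 * Real.sqrt N)) < (gridSize q q0 csa N : ℝ) + 1 :=
    Nat.lt_floor_add_one _
  refine ⟨hN0, ?_, ?_, h1⟩
  · rw [Real.le_logb_iff_rpow_le_of_base_lt_one hq0 hq1 hx, Real.rpow_natCast] at h1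
    rw [gridPt]
    calc csa / Real.sqrt N = q0 * (csa / (q0 * Real.sqrt N)) := by field_simp
      _ ≤ _ := by gcongr
  · rw [Real.logb_lt_iff_lt_rpow_of_base_lt_one hq0 hq1 hx, ← Nat.cast_add_one,
      Real.rpow_natCast, pow_succ] at h2
    rw [gridPt]
    calc q * (q0 * q ^ gridSize q q0 csa N) = q0 * (q ^ gridSize q q0 csa N * q) := by ring
      _ ≤ q0 * (csa / (q0 * Real.sqrt N)) := by gcongr
      _ = csa / Real.sqrt N := by field_simp

theorem norm_selected_sub_le {E : Type*} [SeminormedAddCommGroup E] {u : ℕ → E} {v : E}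
    {K kh : ℕ} {a t : ℝ} (hK : 1 ≤ K) (hkh : kh ≤ K + 1) (ha : 0 ≤ a) (ht : 0 ≤ t)
    (hend : ∀ j, K ≤ j → j ≤ K + 1 → ‖u j - v‖ ≤ a)
    (hstep : ∀ k, kh ≤ k → k < K → ‖u (k + 1) - u k‖ ≤ t) : ‖u kh - v‖ ≤ K * (a + t) := by
  have hK' : (1 : ℝ) ≤ K := by exact_mod_cast hK
  rcases Nat.lt_or_ge K kh with h | h
  · have h1 := hend kh h.le hkh
    nlinarith
  · have h1 := dist_le_Ico_sum_of_dist_le (f := u) (d := fun _ => t) h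
      (fun {k} hk1 hk2 => by rw [dist_comm, dist_eq_norm]; exact hstep k hk1 hk2)
    have h2 : ∑ _i ∈ Finset.Ico kh K, t ≤ K * t := by
      rw [Finset.sum_const, Nat.card_Ico, nsmul_eq_mul]
      gcongr
      exact Nat.sub_le _ _
    have h3 := hend K le_rfl (Nat.le_succ K)
    rw [dist_eq_norm] at h1
    calc ‖u kh - v‖ = ‖(u kh - u K) + (u K - v)‖ := by rw [sub_add_sub_cancel]
      _ ≤ ‖u kh - u K‖ + ‖u K - v‖ := norm_add_le _ _
      _ ≤ K * t + a := add_le_add (h1.trans h2) h3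
      _ ≤ K * (a + t) := by nlinarith

/-! ### The source condition -/

theorem norm_act_matPow_le {d : ℕ} {S : Matrix (Fin d) (Fin d) ℝ} (hS : S.PosSemidef) {c r : ℝ}
    (hr : 0 ≤ r) (hc : ∀ j, hS.1.eigenvalues j ≤ c) (h : Feat d) (hc0 : 0 ≤ c) :
    ‖act (matPow S r) h‖ ≤ c ^ r * ‖h‖ := by
  refine abs_le_of_sq_le_sq' ?_ (by positivity) |>.2
  rw [mul_pow, norm_sq_eq_sum hS.1.eigenvectorBasis, norm_sq_eq_sum hS.1.eigenvectorBasis h,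
    Finset.mul_sum]
  refine Finset.sum_le_sum fun j _ => ?_
  rw [matPow, inner_eigenvectorBasis_specFun hS.1, mul_pow]
  have := hS.eigenvalues_nonneg j
  have := Real.rpow_le_rpow this (hc j) hr
  gcongr

/-- The source condition of order `r`, read off in the eigenbasis at another order `p'`. Passing to
an order `p' > r` needs the positive eigenvalues to be bounded below. -/
theorem abs_inner_le_of_source {d : ℕ} {S : Matrix (Fin d) (Fin d) ℝ} (hS : S.PosSemidef)
    {c κ r p' : ℝ} (hr : 0 < r) (hκ : 0 < κ) (hc0 : 0 ≤ c)
    (hc : ∀ j, hS.1.eigenvalues j ≤ c)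
    (hκ' : p' ≤ r ∨ ∀ j, 0 < hS.1.eigenvalues j → κ ≤ hS.1.eigenvalues j)
    {C : ℝ} {h : Feat d} (hh : ‖h‖ ≤ C) (l : Fin d) :
    |inner ℝ (hS.1.eigenvectorBasis l) (act (matPow S r) h)|
      ≤ C * (c ^ (r - p') + κ ^ (r - p')) * hS.1.eigenvalues l ^ p' := by
  set σ := hS.1.eigenvalues l with hσ
  have hC : 0 ≤ C := (norm_nonneg _).trans hh
  have hσ0 : 0 ≤ σ := hS.eigenvalues_nonneg l
  have hin : |inner ℝ (hS.1.eigenvectorBasis l) h| ≤ C := by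
    refine (abs_real_inner_le_norm _ _).trans ?_
    simpa using hh
  rw [matPow, inner_eigenvectorBasis_specFun hS.1]
  change |σ ^ r * _| ≤ _
  rw [abs_mul, abs_of_nonneg (Real.rpow_nonneg hσ0 r)]
  have hcr : 0 ≤ c ^ (r - p') := Real.rpow_nonneg hc0 _
  have hκr : 0 ≤ κ ^ (r - p') := Real.rpow_nonneg hκ.le _
  rcases hσ0.eq_or_lt with h0 | h0
  · rw [← h0, Real.zero_rpow hr.ne', zero_mul]
    positivity
  · have h1 : σ ^ (r - p') ≤ c ^ (r - p') + κ ^ (r - p') := by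
      rcases le_total p' r with hpr | hpr
      · have := Real.rpow_le_rpow hσ0 (hc l) (sub_nonneg.2 hpr)
        linarith
      · rcases hκ' with h2 | h2
        · have := Real.rpow_le_rpow hσ0 (hc l) (sub_nonneg.2 h2)
          linarith
        · have := Real.rpow_le_rpow_of_nonpos hκ (h2 l h0) (sub_nonpos.2 hpr)
          linarith
    have h2 : σ ^ r = σ ^ (r - p') * σ ^ p' := by rw [← Real.rpow_add h0, sub_add_cancel]
    rw [h2]
    calc σ ^ (r - p') * σ ^ p' * |inner ℝ (hS.1.eigenvectorBasis l) h|
        ≤ (c ^ (r - p') + κ ^ (r - p')) * σ ^ p' * C := by gcongr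
      _ = _ := by ring

/-! ### Rates -/

theorem shift_le_of_perturb {d : ℕ} {A S : Matrix (Fin d) (Fin d) ℝ} (hA : A.PosSemidef)
    {ε B lam : ℝ} (hB : 0 ≤ B) (hε : ε ≤ B * lam)
    (h : ∀ v, inner ℝ v (act S v) ≤ inner ℝ v (act A v) + ε * ‖v‖ ^ 2) (v : Feat d) :
    inner ℝ v (act S v) + lam * ‖v‖ ^ 2
      ≤ (1 + B) * (inner ℝ v (act A v) + lam * ‖v‖ ^ 2) := by
  have h0 : 0 ≤ inner ℝ v (act A v) := by
    rw [← norm_act_matPow_half_sq hA]; positivity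
  nlinarith [h v, mul_le_mul_of_nonneg_right hε (sq_nonneg ‖v‖), mul_nonneg hB h0]

theorem rpow_neg_half_eq {N : ℝ} (hN : 0 ≤ N) : N ^ (-(1 / 2 : ℝ)) = 1 / Real.sqrt N := by
  rw [Real.rpow_neg hN, ← Real.sqrt_eq_rpow, one_div]

theorem one_div_sqrt_le_rpow {N p : ℝ} (hN : 1 ≤ N) (hp1 : p ≤ 1) :
    1 / Real.sqrt N ≤ N ^ (-(p / 2)) := by
  rw [← rpow_neg_half_eq (by linarith)]
  exact Real.rpow_le_rpow_of_exponent_le hN (by linarith)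

/-- A parameter of order `L / √N` has `p`-th power of order `L ^ 2 N ^ (-p/2)` for `p ≤ 2`. -/
theorem rpow_le_rate {k L N p lam : ℝ} (hk : 0 ≤ k) (hL : 1 ≤ L) (hN : 1 ≤ N) (hp0 : 0 ≤ p)
    (hp1 : p ≤ 2) (hlam0 : 0 ≤ lam) (hlam : lam ≤ k * L / Real.sqrt N) :
    lam ^ p ≤ k ^ p * (L ^ 2 * N ^ (-(p / 2))) := by
  have hN0 : 0 ≤ N := by linarith
  have e : k * L / Real.sqrt N = k * (L * N ^ (-(1 / 2 : ℝ))) := by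
    rw [rpow_neg_half_eq hN0]; ring
  have hNr : 0 ≤ N ^ (-(1 / 2 : ℝ)) := Real.rpow_nonneg hN0 _
  have hL2 : L ^ p ≤ L ^ 2 := by
    rw [← Real.rpow_two]
    exact Real.rpow_le_rpow_of_exponent_le hL hp1
  calc lam ^ p ≤ (k * (L * N ^ (-(1 / 2 : ℝ)))) ^ p :=
        Real.rpow_le_rpow hlam0 (hlam.trans_eq e) hp0
    _ = k ^ p * (L ^ p * N ^ (-(p / 2))) := by
        rw [Real.mul_rpow hk (by positivity), Real.mul_rpow (by linarith) hNr,
          ← Real.rpow_mul hN0]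
        ring_nf
    _ ≤ _ := by gcongr

/-- The error at any parameter of order `log (2 / δ) / √N`. -/
theorem norm_half_estimator_sub_le_rate {d n : ℕ} {D : Fin n → Obs d}
    {Cx b R p B Q k L N lam lam0 : ℝ} {qual : EReal} {gam : ℝ → ℝ} {g : ℝ → ℝ → ℝ}
    {S : Matrix (Fin d) (Fin d) ℝ} (hS : S.PosSemidef) (θ : Feat d) (hD : ∀ i, ‖(D i).1‖ ≤ Cx)
    (hg : IsFilter Cx b qual gam g) (hlam : 0 < lam) (hlamle : lam ≤ Cx ^ 2)
    (hp0 : 1 / 2 ≤ p) (hp1 : p ≤ 1) (hpq : (p : EReal) ≤ qual)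
    (hB : 0 ≤ B) (hQ : 0 ≤ Q) (hR : 0 ≤ R) (hk : 0 ≤ k) (hL : 1 ≤ L) (hN : 1 ≤ N)
    (hlam0 : lam0 ≤ lam) (hlamk : lam ≤ k * L / Real.sqrt N) (hQB : Q * L / Real.sqrt N ≤ B * lam)
    (hcov : ∀ v, inner ℝ v (act S v)
      ≤ inner ℝ v (act (empCov D) v) + Q * L / Real.sqrt N * ‖v‖ ^ 2)
    (hξ : ∀ u, inner ℝ (empCross D - act (empCov D) θ) u ^ 2
      ≤ (Q * L / Real.sqrt N) ^ 2 * (inner ℝ u (act S u) + lam0 * ‖u‖ ^ 2))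
    (hθ : ∀ l, |inner ℝ (hS.1.eigenvectorBasis l) θ|
      ≤ R * hS.1.eigenvalues l ^ (p - 1 / 2)) :
    ‖act (matPow S (1 / 2)) (estimator g D lam - θ)‖
      ≤ (1 + B) * (2 * b * Q + d * (R * (2 * ((gam p + 1 + b) * k ^ p))))
        * (L ^ 2 * N ^ (-(p / 2))) := by
  have hb : 0 < b := hg.1
  have hgam : 0 < gam p := hg.2.2.1 p
  have hξ' : ∀ u, inner ℝ (empCross D - act (empCov D) θ) u ^ 2
      ≤ (Q * L / Real.sqrt N) ^ 2 * (inner ℝ u (act S u) + lam * ‖u‖ ^ 2) := fun u =>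
    (hξ u).trans (by gcongr)
  have hrate : L / Real.sqrt N ≤ L ^ 2 * N ^ (-(p / 2)) := by
    have h1 := one_div_sqrt_le_rpow hN hp1
    calc L / Real.sqrt N = L * (1 / Real.sqrt N) := by ring
      _ ≤ L ^ 2 * N ^ (-(p / 2)) := by
          gcongr
          nlinarith
  refine (norm_half_estimator_sub_le hS θ hD hg hlam hlamle hp0 hp1 hpq hB (by positivity) hR
    (shift_le_of_perturb (posSemidef_empCov D) hB hQB hcov) hξ' hθ).trans ?_
  have h1 : lam ^ p ≤ k ^ p * (L ^ 2 * N ^ (-(p / 2))) :=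
    rpow_le_rate hk hL hN (by linarith) (by linarith) hlam.le hlamk
  rw [mul_assoc (1 + B)]
  refine mul_le_mul_of_nonneg_left ?_ (by linarith)
  have h2 : 2 * b * (Q * L / Real.sqrt N) ≤ 2 * b * Q * (L ^ 2 * N ^ (-(p / 2))) := by
    rw [mul_div_assoc, ← mul_assoc]
    gcongr
  have h3 : d * (R * (2 * ((gam p + 1 + b) * lam ^ p)))
      ≤ d * (R * (2 * ((gam p + 1 + b) * k ^ p))) * (L ^ 2 * N ^ (-(p / 2))) := by
    calc d * (R * (2 * ((gam p + 1 + b) * lam ^ p)))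
        ≤ d * (R * (2 * ((gam p + 1 + b) * (k ^ p * (L ^ 2 * N ^ (-(p / 2))))))) := by gcongr
      _ = _ := by ring
  rw [add_mul (2 * b * Q)]
  exact add_le_add h2 h3

/-- The number of grid points is at most a constant multiple of `log_q (N ^ (-1/2))`. -/
theorem le_mul_logb {q q0 Ks L N K : ℝ} (hq0 : 0 < q) (hq1 : q < 1) (hq00 : 0 < q0)
    (hKs : 0 < Ks) (hL : 1 ≤ L) (hN : 4 ≤ N)
    (hK : K ≤ Real.logb q (Ks * L / (q0 * Real.sqrt N))) :
    K ≤ (1 + |Real.logb q (Ks / q0)| / Real.logb q (1 / 2)) * Real.logb q (N ^ (-(1 / 2 : ℝ))) := by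
  have hN0 : 0 < N := by linarith
  have hsN : 2 ≤ Real.sqrt N := Real.le_sqrt_of_sq_le (by linarith)
  have hη : 0 < Real.logb q (1 / 2) :=
    Real.logb_pos_of_base_lt_one hq0 hq1 (by norm_num) (by norm_num)
  rw [rpow_neg_half_eq hN0.le]
  have hY : Real.logb q (1 / 2) ≤ Real.logb q (1 / Real.sqrt N) := by
    rw [Real.logb_le_logb_of_base_lt_one hq0 hq1 (by norm_num) (by positivity)]
    gcongr
  have h1 : Ks * L / (q0 * Real.sqrt N) = Ks * L / q0 * (1 / Real.sqrt N) := by field_simp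
  rw [h1, Real.logb_mul (by positivity) (by positivity)] at hK
  have h2 : Real.logb q (Ks * L / q0) ≤ Real.logb q (Ks / q0) := by
    rw [Real.logb_le_logb_of_base_lt_one hq0 hq1 (by positivity) (by positivity)]
    gcongr
    exact le_mul_of_one_le_right hKs.le hL
  have h3 : |Real.logb q (Ks / q0)|
      ≤ |Real.logb q (Ks / q0)| / Real.logb q (1 / 2) * Real.logb q (1 / Real.sqrt N) := by
    calc |Real.logb q (Ks / q0)|
        = |Real.logb q (Ks / q0)| / Real.logb q (1 / 2) * Real.logb q (1 / 2) := by field_simp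
      _ ≤ _ := by gcongr
  linarith [le_abs_self (Real.logb q (Ks / q0))]

end SpectralRegression

/-! ### The adaptive estimator -/

theorem mainTheorem3
    (d : ℕ) (hd : 2 ≤ d)
    -- constants of the mixing, boundedness, source and effective dimension assumptions
    (b0 c0 γ0 : ℝ) (hb0 : 0 < b0) (hc0 : 0 ≤ c0) (hγ0 : 0 < γ0)
    (Cx M : ℝ) (hCx : 0 < Cx) (hM : 0 < M)
    (r C : ℝ) (hr : 0 < r) (hC : 0 < C)
    (s C0 : ℝ) (hs0 : 0 ≤ s) (hs1 : s ≤ 1) (hC0 : 1 ≤ C0)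
    -- the filter
    (g : ℝ → ℝ → ℝ) (b : ℝ) (qual : EReal) (gam : ℝ → ℝ)
    (hg : SpectralRegression.IsFilter Cx b qual gam g)
    (hqual : (((2 * r + 1) / (2 * r + s + 1) : ℝ) : EReal) ≤ qual)
    -- the constants of the selection rule
    (ct : ℝ) (hct0 : 0 < ct) (hct1 : ct < 1 / 2)
    (q q0 : ℝ) (hq0 : 0 < q) (hq1 : q < 1) (hq00 : 0 < q0) (hgrid : q0 * q ≤ Cx ^ 2)
    -- a lower bound for the positive eigenvalues of `Σ`, relevant only if `2 r + s < 1`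
    (κ : ℝ) (hκ : 0 < κ) :
    ∃ C2 : ℝ, 0 < C2 ∧
      ∀ (Ω : Type u) [MeasurableSpace Ω] (μ : Measure Ω) [IsProbabilityMeasure μ]
        (P : Measure (SpectralRegression.Obs d)) [IsProbabilityMeasure P]
        (z : ℕ → Ω → SpectralRegression.Obs d) (θ : SpectralRegression.Feat d),
        (∀ i, Measurable (z i)) →
        (∀ i, μ.map (z i) = P) →
        -- `E[Y | X] = ⟨X, θ⟩`
        P[fun w => w.2 | MeasurableSpace.comap Prod.fst inferInstance]
          =ᵐ[P] (fun w => inner ℝ w.1 θ) →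
        SpectralRegression.IsGeomTauMixing μ z b0 c0 γ0 →
        (∀ᵐ w ∂P, ‖w.1‖ ≤ Cx ∧ |w.2| ≤ M) →
        -- source condition `‖Σ ^ (-r) θ‖ ≤ C`
        (∃ h : SpectralRegression.Feat d, ‖h‖ ≤ C ∧
          θ = SpectralRegression.act
            (SpectralRegression.matPow (SpectralRegression.popCov P) r) h) →
        (∀ lam : ℝ, 0 < lam →
          SpectralRegression.effDim (SpectralRegression.popCov P) lam ≤ C0 * lam ^ (-s)) →
        (1 ≤ 2 * r + s ∨
          ∀ ev ∈ spectrum ℝ (SpectralRegression.popCov P), 0 < ev → κ ≤ ev) →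
        ∀ (n : ℕ) (δ : ℝ), 0 < δ → δ < 1 / 2 →
          1 ≤ SpectralRegression.gridSize q q0 (SpectralRegression.constSa Cx C0 ct δ)
              (SpectralRegression.effSize b0 c0 γ0 Cx M ‖θ‖ n) →
          μ {ω | ¬ (‖SpectralRegression.act
                  (SpectralRegression.matPow (SpectralRegression.popCov P) (1 / 2))
                  (SpectralRegression.adaptiveEstimator g b ct Cx M C0 b0 c0 γ0 δ q q0 ‖θ‖
                    (fun i : Fin n => z i ω) - θ)‖
                ≤ C2 * (SpectralRegression.effSize b0 c0 γ0 Cx M ‖θ‖ n)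
                        ^ (-((r + 1 / 2) / (2 * r + s + 1)))
                    * (Real.log d) ^ (2 / γ0) * (Real.log (2 / δ)) ^ 2
                    * Real.logb q
                        ((SpectralRegression.effSize b0 c0 γ0 Cx M ‖θ‖ n) ^ (-(1 / 2 : ℝ)))
                    * (1 + if 1 / 2 < r then (Real.log (2 / δ)) ^ (min 1 r) else 0))}
            ≤ ENNReal.ofReal δ := by
  -- the rate is `N ^ (-p / 2)`
  set p : ℝ := (2 * r + 1) / (2 * r + s + 1) with hp
  have hden : 0 < 2 * r + s + 1 := by linarith
  have hp0 : 1 / 2 ≤ p := by rw [hp, le_div_iff₀ hden]; linarith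
  have hp1 : p ≤ 1 := by rw [hp, div_le_one hden]; linarith
  set Ks : ℝ := 21 * Cx * (1 + 2 * Cx) * (Real.sqrt C0 + 1) / ct with hKs
  have hKs2 : 2 * Cx ^ 2 ≤ Ks := by
    have h1 : 1 ≤ Real.sqrt C0 + 1 := le_add_of_nonneg_left (Real.sqrt_nonneg _)
    rw [hKs, le_div_iff₀ hct0]
    calc 2 * Cx ^ 2 * ct ≤ 2 * Cx ^ 2 * 1 := by gcongr; linarith
      _ ≤ 21 * Cx * (1 + 2 * Cx) * 1 := by nlinarith
      _ ≤ _ := by gcongr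
  have hKs0 : 0 < Ks := lt_of_lt_of_le (by positivity) hKs2
  have hκ₁ : 0 < q * Ks := by positivity
  obtain ⟨Q, hQ0, hQ⟩ := SpectralRegression.exists_deviation_const.{u} d (by omega) hb0 hCx hM
    (ρ := (Cx ^ 2) ^ r * C) (by positivity) hκ₁
  have hd1 : 1 ≤ d := by omega
  have hb : 0 < b := hg.1
  have hgam : 0 < gam p := hg.2.2.1 p
  set R : ℝ := C * ((Cx ^ 2) ^ (r - (p - 1 / 2)) + κ ^ (r - (p - 1 / 2))) with hR
  have hR0 : 0 ≤ R := by positivity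
  set B : ℝ := Q / (q * Ks) with hB
  have hB0 : 0 ≤ B := by positivity
  set Ce : ℝ := (1 + B) * (2 * b * Q + d * (R * (2 * ((gam p + 1 + b) * (Ks / q) ^ p)))) with hCe
  have hCe0 : 0 < Ce := by positivity
  set H : ℝ := (1 + Real.log (2 * Real.sqrt d)) ^ (1 / γ0) with hH
  have hH0 : 0 < H := by
    have h1 : (1 : ℝ) ≤ Real.sqrt d := Real.one_le_sqrt.2 (by exact_mod_cast hd1)
    have h2 : 0 ≤ Real.log (2 * Real.sqrt d) := Real.log_nonneg (by linarith)
    exact Real.rpow_pos_of_pos (by linarith) _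
  set Cw : ℝ := (1 + 4 * (13 * Cx / Real.sqrt (q * Ks / H) + 21 * Cx ^ 2 / (q * Ks / H)))
      * Real.sqrt d + 1 / Real.sqrt (q * Ks) with hCw
  have hCw0 : 0 ≤ Cw := by positivity
  set Th : ℝ := 168 * b * Real.sqrt ((1 - ct) / (1 - 2 * ct)) * Real.sqrt (1 / (1 - 2 * ct))
      * M * (1 + Cx) with hTh
  have hTh0 : 0 ≤ Th := by positivity
  set Ct : ℝ := Real.sqrt (1 + B) * (Th * Cw) with hCt
  have hCt0 : 0 ≤ Ct := by positivity
  set m₁ : ℝ := 1 + |Real.logb q (Ks / q0)| / Real.logb q (1 / 2) with hm₁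
  have hm₁0 : 0 < m₁ := by
    have : 0 < Real.logb q (1 / 2) :=
      Real.logb_pos_of_base_lt_one hq0 hq1 (by norm_num) (by norm_num)
    positivity
  have hlogd : 0 < (Real.log d) ^ (2 / γ0) :=
    Real.rpow_pos_of_pos (Real.log_pos (by exact_mod_cast (by omega : 1 < d))) _
  -- the constants are fixed; from here on only the facts recorded above matter
  clear_value Ks R B Ce H Cw Th Ct m₁
  refine ⟨(Ce + Ct) * m₁ / (Real.log d) ^ (2 / γ0), by positivity, ?_⟩
  intro Ω _ μ _ P _ z θ hz hP hreg hmix hbd ⟨h, hhC, hθ⟩ _ hκS n δ hδ hδ2 hK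
  have hCxP : ∀ᵐ w ∂P, ‖w.1‖ ≤ Cx := hbd.mono fun w hw => hw.1
  have hS := SpectralRegression.posSemidef_popCov hCxP
  have hSle := SpectralRegression.eigenvalues_popCov_le hCxP
  have hθρ : ‖θ‖ ≤ (Cx ^ 2) ^ r * C := by
    rw [hθ]
    refine (SpectralRegression.norm_act_matPow_le hS hr.le hSle h (by positivity)).trans ?_
    gcongr
  have hsource : ∀ l, |inner ℝ (hS.1.eigenvectorBasis l) θ|
      ≤ R * hS.1.eigenvalues l ^ (p - 1 / 2) := by
    intro l
    rw [hθ, hR]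
    refine SpectralRegression.abs_inner_le_of_source hS hr hκ (by positivity) hSle ?_ hhC l
    rcases hκS with h1 | h1
    · left
      have : p ≤ (2 * r + 1) / 2 := by
        rw [hp]
        exact div_le_div_of_nonneg_left (by linarith) (by norm_num) (by linarith)
      linarith
    · exact Or.inr fun j hj => h1 _ (hS.1.eigenvalues_mem_spectrum_real j) hj
  set N : ℝ := SpectralRegression.effSize b0 c0 γ0 Cx M ‖θ‖ n with hN
  set L : ℝ := Real.log (2 / δ) with hL
  have hL1 : 1 ≤ L := SpectralRegression.one_le_log_two_div hδ hδ2
  have hcsa : SpectralRegression.constSa Cx C0 ct δ = Ks * L := by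
    rw [hKs]; rfl
  rw [hcsa] at hK
  set K := SpectralRegression.gridSize q q0 (Ks * L) N with hKdef
  have hNnn : 0 ≤ N := by
    rw [hN, SpectralRegression.effSize]
    have : (0 : ℝ) ≤ max 1 (Real.log (c0 * b0 * max (Real.sqrt 2 * max (M + 2 * Cx * ‖θ‖) Cx
        / (2 * Cx * M)) (1 / Cx) * n)) := zero_le_one.trans (le_max_left _ _)
    positivity
  obtain ⟨hN0, hgrid1, hgrid2, hKlog⟩ :=
    SpectralRegression.gridSize_spec hq0 hq1 hq00 (by positivity : 0 < Ks * L) hNnn hK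
  rw [← hKdef] at hgrid1 hgrid2 hKlog
  have hsN0 : 0 < Real.sqrt N := Real.sqrt_pos.2 hN0
  have hgrid_anti : ∀ {i j : ℕ}, i ≤ j →
      SpectralRegression.gridPt q q0 j ≤ SpectralRegression.gridPt q q0 i := by
    intro i j hij
    exact mul_le_mul_of_nonneg_left (pow_le_pow_of_le_one hq0.le hq1.le hij) hq00.le
  have hgrid_le : ∀ {j : ℕ}, 1 ≤ j → SpectralRegression.gridPt q q0 j ≤ Cx ^ 2 := by
    intro j hj
    refine (hgrid_anti hj).trans ?_
    rw [SpectralRegression.gridPt, pow_one]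
    exact hgrid
  have hgrid_pos : ∀ j, 0 < SpectralRegression.gridPt q q0 j := fun j => by
    rw [SpectralRegression.gridPt]; positivity
  -- a nonempty grid forces the effective sample size to be at least `4`
  have hsN2 : 2 ≤ Real.sqrt N := by
    have h1 := hgrid1.trans (hgrid_le hK)
    rw [div_le_iff₀ hsN0] at h1
    have h2 : Cx ^ 2 * 2 ≤ Cx ^ 2 * Real.sqrt N := by
      calc Cx ^ 2 * 2 = 2 * Cx ^ 2 := mul_comm _ _
        _ ≤ Ks := hKs2
        _ ≤ Ks * L := le_mul_of_one_le_right hKs0.le hL1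
        _ ≤ _ := h1
    exact le_of_mul_le_mul_left h2 (by positivity)
  have hN4 : 4 ≤ N := by
    have h1 := pow_le_pow_left₀ zero_le_two hsN2 2
    rw [Real.sq_sqrt hNnn] at h1
    linarith
  have hN1 : 1 ≤ N := by linarith
  -- a lower bound for all parameters up to the index `K + 1`
  set lam0 : ℝ := q * (Ks * L / Real.sqrt N) with hlam0
  have hlam0pos : 0 < lam0 := by positivity
  have hlam0N : q * Ks ≤ lam0 * N := by
    have h1 : lam0 * Real.sqrt N ^ 2 = q * Ks * (L * Real.sqrt N) := by
      rw [hlam0]; field_simp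
    rw [Real.sq_sqrt hNnn] at h1
    rw [h1]
    exact le_mul_of_one_le_right hκ₁.le (one_le_mul_of_one_le_of_one_le hL1 (one_le_two.trans hsN2))
  have hQB : ∀ {lam : ℝ}, lam0 ≤ lam → Q * L / Real.sqrt N ≤ B * lam := by
    intro lam hlam
    have h1 : Q * L / Real.sqrt N = B * lam0 := by
      rw [hB, hlam0]; field_simp
    rw [h1]
    gcongr
  obtain ⟨E, hE, hEω⟩ := hQ hc0 hγ0 hz hP hreg hmix hbd hθρ hN hN1 hδ hδ2 hlam0pos hlam0N
  refine (measure_mono ?_).trans hE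
  intro ω hω
  by_contra hωE
  obtain ⟨hx, hcov, hξ⟩ := hEω ω hωE
  rw [Set.mem_ofPred_eq] at hω
  refine hω ?_
  clear hω hEω hE hQ
  set D : Fin n → SpectralRegression.Obs d := fun i => z i ω with hD
  set S := SpectralRegression.popCov P with hSdef
  rw [SpectralRegression.adaptiveEstimator, hcsa, ← hN, ← hKdef]
  set ell := SpectralRegression.ellThree b0 c0 γ0 Cx d n with hell
  set kh := SpectralRegression.kHat g b ct Cx M δ q q0 N ell K D with hkh
  obtain ⟨hkh1, hkh2, hkh3⟩ := SpectralRegression.kHat_spec g b ct Cx M δ q q0 N ell hK D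
  rw [← hkh] at hkh1 hkh2 hkh3
  have hNell : N ≤ H * ell := by
    rw [hN, hH, hell]
    exact SpectralRegression.effSize_le_mul_ellThree hb0 hc0 hγ0 hCx hd1 n
  set rate : ℝ := L ^ 2 * N ^ (-(p / 2)) with hrate
  have hrate0 : 0 ≤ rate := by positivity
  -- the selected index can be `K + 1`, so that the last grid point is not the only endpoint
  have hend : ∀ j, K ≤ j → j ≤ K + 1 →
      ‖SpectralRegression.act (SpectralRegression.matPow S (1 / 2))
          (SpectralRegression.estimator g D (SpectralRegression.gridPt q q0 j))
        - SpectralRegression.act (SpectralRegression.matPow S (1 / 2)) θ‖ ≤ Ce * rate := by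
    intro j hj1 hj2
    have hlow : lam0 ≤ SpectralRegression.gridPt q q0 j := by
      refine le_trans ?_ (hgrid_anti hj2)
      have : SpectralRegression.gridPt q q0 (K + 1)
          = q * SpectralRegression.gridPt q q0 K := by
        rw [SpectralRegression.gridPt, SpectralRegression.gridPt, pow_succ]; ring
      rw [this]
      exact mul_le_mul_of_nonneg_left hgrid1 hq0.le
    have hupp : SpectralRegression.gridPt q q0 j ≤ Ks / q * L / Real.sqrt N := by
      refine (hgrid_anti hj1).trans ?_
      have h1 : Ks / q * L / Real.sqrt N = Ks * L / Real.sqrt N / q := by field_simp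
      rw [h1, le_div_iff₀ hq0, mul_comm]
      exact hgrid2
    rw [← SpectralRegression.act_sub, hCe]
    exact SpectralRegression.norm_half_estimator_sub_le_rate hS θ (fun i => hx i) hg (hgrid_pos j)
      (hgrid_le (hK.trans hj1)) hp0 hp1 hqual hB0 hQ0.le hR0 (by positivity) hL1 hN1 hlow hupp
      (hQB hlow) hcov hξ hsource
  have hstep : ∀ k, kh ≤ k → k < K →
      ‖SpectralRegression.act (SpectralRegression.matPow S (1 / 2))
          (SpectralRegression.estimator g D (SpectralRegression.gridPt q q0 (k + 1)))
        - SpectralRegression.act (SpectralRegression.matPow S (1 / 2))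
          (SpectralRegression.estimator g D (SpectralRegression.gridPt q q0 k))‖
      ≤ Ct * rate := by
    intro k hk1 hk2
    have hnot := hkh3 k hk1 hk2
    rw [SpectralRegression.Exceeds, not_le, ← hTh, ← hL] at hnot
    have hlow : lam0 ≤ SpectralRegression.gridPt q q0 (k + 1) := by
      refine le_trans ?_ (hgrid1.trans (hgrid_anti hk2))
      rw [hlam0]
      exact mul_le_of_le_one_left (by positivity) hq1.le
    have hw := SpectralRegression.wTerm_le hd1 D hCx hN1 (hgrid_pos (k + 1)) hH0 hκ₁
      (hlam0N.trans (by gcongr)) hNell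
    rw [← hCw] at hw
    rw [← SpectralRegression.act_sub]
    refine (SpectralRegression.norm_act_half_le (SpectralRegression.posSemidef_empCov D) hS
      (hgrid_pos (k + 1)) (SpectralRegression.shift_le_of_perturb
        (SpectralRegression.posSemidef_empCov D) hB0 (hQB hlow) hcov) _).trans ?_
    rw [hCt, mul_assoc]
    refine mul_le_mul_of_nonneg_left (hnot.le.trans ?_) (Real.sqrt_nonneg _)
    calc Th * SpectralRegression.wTerm Cx N ell D (SpectralRegression.gridPt q q0 (k + 1)) * L ^ 2
        ≤ Th * (Cw / Real.sqrt N) * L ^ 2 := by gcongr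
      _ = Th * Cw * (L ^ 2 * (1 / Real.sqrt N)) := by ring
      _ ≤ Th * Cw * rate := by
          rw [hrate]
          gcongr
          exact SpectralRegression.one_div_sqrt_le_rpow hN1 hp1
  have hfinal := SpectralRegression.norm_selected_sub_le
    (u := fun j => SpectralRegression.act (SpectralRegression.matPow S (1 / 2))
      (SpectralRegression.estimator g D (SpectralRegression.gridPt q q0 j)))
    hK hkh1 (mul_nonneg hCe0.le hrate0) (mul_nonneg hCt0 hrate0) hend hstep
  have hKY : (K : ℝ) ≤ m₁ * Real.logb q (N ^ (-(1 / 2 : ℝ))) := by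
    rw [hm₁]
    exact SpectralRegression.le_mul_logb hq0 hq1 hq00 hKs0 hL1 hN4 hKlog
  set Y : ℝ := Real.logb q (N ^ (-(1 / 2 : ℝ))) with hY
  have hY0 : 0 ≤ m₁ * Y := (Nat.cast_nonneg K).trans hKY
  have hexp : -((r + 1 / 2) / (2 * r + s + 1)) = -(p / 2) := by
    rw [hp]; field_simp
  have hbr : 1 ≤ 1 + if 1 / 2 < r then L ^ (min 1 r) else 0 := by
    split_ifs
    · exact le_add_of_nonneg_right (Real.rpow_nonneg (by linarith) _)
    · simp
  rw [SpectralRegression.act_sub, hexp]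
  refine hfinal.trans ?_
  calc (K : ℝ) * (Ce * rate + Ct * rate) ≤ m₁ * Y * (Ce * rate + Ct * rate) := by gcongr
    _ = (Ce + Ct) * m₁ / (Real.log d) ^ (2 / γ0) * N ^ (-(p / 2)) * (Real.log d) ^ (2 / γ0)
          * L ^ 2 * Y * 1 := by
        rw [hrate]; field_simp
    _ ≤ _ := by
        refine mul_le_mul_of_nonneg_left hbr ?_
        have h1 : (Ce + Ct) * m₁ / (Real.log d) ^ (2 / γ0) * N ^ (-(p / 2))
            * (Real.log d) ^ (2 / γ0) * L ^ 2 * Y = m₁ * Y * ((Ce + Ct) * rate) := by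
          rw [hrate]; field_simp
        rw [h1]
        positivity
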